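/- Let $p>4/3$. There is a constant $C>0$, depending only on $p$, such that the following holds. Let $e\neq 0$ and $g$ be real numbers and fix one of the signs $\pm$. Let $B^{\rm ext}>0$ be a constant, $\boldsymbol A^{\rm ext}(x)=\frac{B^{\rm ext}}{2}(-x_2,x_1)$, let $\boldsymbol a^{\rm ind}\in L_2^{\rm loc}(\mathbb R^2;\mathbb R^2)$ and let $b^{\rm ind}={\rm curl}\,\boldsymbol a^{\rm ind}$ in the sense of distributions be a real function such that either $b^{\rm ind}\in L_p(\mathbb R^2)$, or $b^{\rm ind}\in L_p^{\rm loc}(\mathbb R^2)$ and $\lim_{\kappa\to\infty}\|\chi_{\{|x|\ge\kappa\}}b^{\rm ind}\|_\infty=0$. Put $\boldsymbol A_\pm=e\boldsymbol A^{\rm ext}\pm g\boldsymbol a^{\rm ind}$ and $B_\pm=eB^{\rm ext}\pm g b^{\rm ind}$. Write $\boldsymbol p_{\boldsymbol A}=-i\boldsymbol\nabla-\boldsymbol A$ and $\boldsymbol P_{\boldsymbol A}=\sigma_1(\boldsymbol p_{\boldsymbol A})_1+\sigma_2(\boldsymbol p_{\boldsymbol A})_2$, where $\sigma_1=\begin{pmatrix}0&1\\1&0\end{pmatrix}$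 and $\sigma_2=\begin{pmatrix}0&-i\\i&0\end{pmatrix}$. For $\varepsilon>0$ let $\mathscr A$ be the set of all closed dyadic squares $S\subset\mathbb R^2$, of side length $\ell(S)=2^k$ with $k\in\mathbb Z$, such that $$\Bigl(\int_{12S}|B_\pm(y)|^p\,dy\Bigr)^{1/p}\le \frac{\varepsilon}{\ell(S)^{(3p-4)/(2p)}},$$ where $tS$ is the square with the same center as $S$ and side length $t\,\ell(S)$, and let $\{S_j\}$ be the family of the squares in $\mathscr A$ that are not properly contained in another square of $\mathscr A$; put $\ell_j=\ell(S_j)$. Then there is $\varepsilon_0>0$ such that, for every $0<\varepsilon<\varepsilon_0$ and every family of functions $\phi_j\in C_0^\infty(2S_j;\mathbb R)$ with $0\le\phi_j\le 1$, with $|\nabla^\alpha\phi_j|\le C_\alpha\,\ell_j^{-|\alpha|}$ for all $j$ and all multi-indices $\alpha$ (for some constants $C_\alpha$), and with $\sum_j\phi_j^2\equiv 1$ in $\mathbb R^2$, the function $\boldsymbol\varPhi=\sum_j\ell_j^{-3/2}\phi_j^2$ satisfies $$\boldsymbol p_{\boldsymbol A_\pm}^2\le C\bigl(\boldsymbol P_{\boldsymbol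 A_\pm}^2+\boldsymbol\varPhi\bigr)$$ in the sense of quadratic forms in $L_2(\mathbb R^2;\mathbb C^2)$: that is, $$\int_{\mathbb R^2}|\boldsymbol p_{\boldsymbol A_\pm}\Psi|^2\,dx\le C\Bigl(\int_{\mathbb R^2}|\boldsymbol P_{\boldsymbol A_\pm}\Psi|^2\,dx+\int_{\mathbb R^2}\boldsymbol\varPhi\,|\Psi|^2\,dx\Bigr)$$ for all $\Psi\in C_0^\infty(\mathbb R^2;\mathbb C^2)$, and the same inequality holds between the closures in $L_2$ of the two forms (in particular the form domain of the right-hand side is contained in that of the left-hand side). -/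

import Mathlib

open MeasureTheory Filter Topology
open scoped ENNReal ContDiff

noncomputable section

namespace PauliDomination

/-- The Euclidean plane. -/
abbrev Plane : Type := EuclideanSpace ℝ (Fin 2)

/-- The spinor space `ℂ²` with its Hermitian norm. -/
abbrev Spinor : Type := EuclideanSpace ℂ (Fin 2)

/-- `f` belongs to `L^p_loc`. -/
def LocMemLp {F : Type} [NormedAddCommGroup F] (f : Plane → F) (p : ℝ≥0∞) : Prop :=
  ∀ K : Set Plane, IsCompact K → MemLp f p (volume.restrict K)

/-- The partial derivative `∂_i f` at `x`. -/
def partialDeriv {F : Type} [NormedAddCommGroup F] [NormedSpace ℝ F]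
    (i : Fin 2) (f : Plane → F) (x : Plane) : F :=
  fderiv ℝ f x (EuclideanSpace.single i (1 : ℝ))

/-! ### Magnetic fields and vector potentials -/

/-- `b = curl a = ∂₁ a₂ - ∂₂ a₁` in the sense of distributions. -/
def IsDistribCurl (a : Plane → Plane) (b : Plane → ℝ) : Prop :=
  ∀ η : Plane → ℝ, ContDiff ℝ ∞ η → HasCompactSupport η →
    ∫ x, b x * η x = ∫ x, (a x 0 * partialDeriv 1 η x - a x 1 * partialDeriv 0 η x)

/-- `lim_{κ → ∞} ‖χ_{|x| ≥ κ} b‖_∞ = 0`. -/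
def VanishesAtInfinity (b : Plane → ℝ) : Prop :=
  Tendsto (fun κ : ℝ => eLpNorm ({x : Plane | κ ≤ ‖x‖}.indicator b) ∞ volume) atTop (𝓝 0)

/-- The potential `A^ext = (B^ext / 2) (-x₂, x₁)` of the homogeneous field `B^ext`. -/
def extPotential (Bext : ℝ) (x : Plane) : Plane :=
  (Bext / 2) • !₂[-(x 1), x 0]

/-- The total field `e B^ext + s g b`; the sign `s = 1` gives `B₊` and `s = -1` gives `B₋`. -/
def totalField (e g Bext s : ℝ) (b : Plane → ℝ) (x : Plane) : ℝ :=
  e * Bext + s * g * b x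

/-- The total potential `e A^ext + s g a`; the sign `s = 1` gives `A₊`, `s = -1` gives `A₋`. -/
def totalPotential (e g Bext s : ℝ) (a : Plane → Plane) (x : Plane) : Plane :=
  e • extPotential Bext x + (s * g) • a x

/-! ### The operators -/

/-- The `i`-th component of `p_A = -i∇ - A`, acting on each spinor component. -/
def magMomentum (A : Plane → Plane) (i : Fin 2) (Ψ : Plane → Spinor) (x : Plane) : Spinor :=
  -(Complex.I • partialDeriv i Ψ x) - ((A x i : ℝ) : ℂ) • Ψ x

/-- The Pauli matrices `σ₁`, `σ₂`. -/
def pauliMatrix : Fin 2 → Matrix (Fin 2) (Fin 2) ℂ :=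
  ![!![0, 1; 1, 0], !![0, -Complex.I; Complex.I, 0]]

/-- `P_A = σ · p_A`. -/
def pauliDirac (A : Plane → Plane) (Ψ : Plane → Spinor) (x : Plane) : Spinor :=
  ∑ i : Fin 2, Matrix.toEuclideanLin (pauliMatrix i) (magMomentum A i Ψ x)

/-- Test spinors: `C_0^∞(ℝ²; ℂ²)`. -/
def IsTestSpinor (Ψ : Plane → Spinor) : Prop :=
  ContDiff ℝ ∞ Ψ ∧ HasCompactSupport Ψ

/-- The quadratic form of `p_A²`, `∫ |p_A Ψ|²`, on test spinors. -/
def schrodingerForm (A : Plane → Plane) (Ψ : Plane → Spinor) : ℝ≥0∞ :=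
  ∫⁻ x, ∑ i : Fin 2, ‖magMomentum A i Ψ x‖ₑ ^ 2

/-- The quadratic form of `P_A²`, `∫ |P_A Ψ|²`, on test spinors. -/
def pauliForm (A : Plane → Plane) (Ψ : Plane → Spinor) : ℝ≥0∞ :=
  ∫⁻ x, ‖pauliDirac A Ψ x‖ₑ ^ 2

/-- The quadratic form `∫ W |Ψ|²` of a nonnegative potential `W`. -/
def potentialForm (W : Plane → ℝ) (Ψ : Plane → Spinor) : ℝ≥0∞ :=
  ∫⁻ x, ENNReal.ofReal (W x) * ‖Ψ x‖ₑ ^ 2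

/-- The closure in `L²` of a nonnegative form given on test spinors, as the lower semicontinuous
relaxation; it takes the value `∞` exactly off the form domain of the closure. -/
def formClosure (q : (Plane → Spinor) → ℝ≥0∞) (Ψ : Plane → Spinor) : ℝ≥0∞ :=
  ⨅ (u : ℕ → Plane → Spinor) (_ : ∀ n, IsTestSpinor (u n))
    (_ : Tendsto (fun n => eLpNorm (u n - Ψ) 2 volume) atTop (𝓝 0)),
    liminf (fun n => q (u n)) atTop

/-- `q₁ ≤ C q₂` in the sense of forms: on the common core of test spinors, and for the closed
forms on all of `L²` (so that the form domain of `q₂` lies in that of `q₁`). -/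
def FormLE (q₁ : (Plane → Spinor) → ℝ≥0∞) (C : ℝ) (q₂ : (Plane → Spinor) → ℝ≥0∞) : Prop :=
  (∀ Ψ, IsTestSpinor Ψ → q₁ Ψ ≤ ENNReal.ofReal C * q₂ Ψ) ∧
  (∀ Ψ : Plane → Spinor, MemLp Ψ 2 volume →
    formClosure q₁ Ψ ≤ ENNReal.ofReal C * formClosure q₂ Ψ)

/-! ### Dyadic squares and the localization potential -/

/-- The dyadic square `[2^k m₁, 2^k (m₁ + 1)] × [2^k m₂, 2^k (m₂ + 1)]`. -/
structure DyadicSquare where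
  /-- the exponent `k` -/
  scale : ℤ
  /-- the lattice point `m` -/
  pos : Fin 2 → ℤ

namespace DyadicSquare

/-- The side length `ℓ(S)`. -/
def side (S : DyadicSquare) : ℝ := (2 : ℝ) ^ S.scale

/-- The coordinates of the center of `S`. -/
def center (S : DyadicSquare) (i : Fin 2) : ℝ := S.side * (S.pos i + 1 / 2)

/-- The square `tS` with the center of `S` and the side length `t ℓ(S)`. -/
def dilate (t : ℝ) (S : DyadicSquare) : Set Plane :=
  {x | ∀ i, |x i - S.center i| ≤ t * S.side / 2}

/-- The square itself, as a set. -/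
def toSet (S : DyadicSquare) : Set Plane := S.dilate 1

end DyadicSquare

/-- The squares with `(∫_{12S} |B|^p)^{1/p} ≤ ε / ℓ(S)^{(3p-4)/(2p)}`. -/
def admissible (B : Plane → ℝ) (p ε : ℝ) : Set DyadicSquare :=
  {S | eLpNorm B (ENNReal.ofReal p) (volume.restrict (S.dilate 12)) ≤
    ENNReal.ofReal (ε / S.side ^ ((3 * p - 4) / (2 * p)))}

/-- The maximal admissible squares: those not properly contained in an admissible one. -/
def maximalSquares (B : Plane → ℝ) (p ε : ℝ) : Set DyadicSquare :=
  {S | S ∈ admissible B p ε ∧ ∀ T ∈ admissible B p ε, ¬ S.toSet ⊂ T.toSet}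

/-- `φ` is a (quadratic) partition of unity subordinate to the squares `2S`, `S ∈ 𝓑`, with
derivatives of order `n` bounded by a constant times `ℓ(S)^{-n}`. -/
structure IsSquarePartition (𝓑 : Set DyadicSquare) (φ : 𝓑 → Plane → ℝ) : Prop where
  smooth : ∀ S, ContDiff ℝ ∞ (φ S)
  support : ∀ S, tsupport (φ S) ⊆ S.1.dilate 2
  nonneg : ∀ S x, 0 ≤ φ S x
  le_one : ∀ S x, φ S x ≤ 1
  deriv_bound : ∀ n : ℕ, ∃ c : ℝ, ∀ S x,
    ‖iteratedFDeriv ℝ n (φ S) x‖ ≤ c / S.1.side ^ n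
  sum_sq : ∀ x, HasSum (fun S => φ S x ^ 2) 1

/-- The localization potential `∑_S ℓ(S)^{-3/2} φ_S²`. -/
def locPotential (𝓑 : Set DyadicSquare) (φ : 𝓑 → Plane → ℝ) (x : Plane) : ℝ :=
  ∑' S : 𝓑, 1 / S.1.side ^ (3 / 2 : ℝ) * φ S x ^ 2

end PauliDomination

end

/-! By the Lichnerowicz formula $P_A^2=p_A^2-\sigma_3B$, so $p_A^2\le P_A^2+|B|$
(`schrodingerForm_le`). It therefore suffices to show $|B|\le\frac12p_A^2+4\varPhi$ as forms
(`lintegral_field_mul_le`) and to absorb the first term, which is finite on test spinors.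

The half-open maximal squares tile the plane, so the bound on $|B|$ is proved square by square. On a
square of side $\ell$, Hölder with exponents $4/3$ and $4$, the embedding $W^{1,1}\subset L^2$
applied to $|\Psi|^2$ and $|\Psi|^4$, and the diamagnetic inequality give $\int_S|B||\Psi|^2\le
7\|B\|_{L^{4/3}(S)}(\ell^{1/2}\int_S|p_A\Psi|^2+\ell^{-3/2}\int_S|\Psi|^2)$
(`lintegral_halfOpen_mul_sq_le`). The threshold defining admissible squares is the one that makes
$\|B\|_{L^{4/3}(S)}\le\varepsilon$ (`eLpNorm_four_thirds_le`).

Two facts on maximal squares remain. Their sides are at most some $L$, since the homogeneous part of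
the field is nonzero and $b$ is negligible on large scales (`exists_side_bound_totalField`); hence
$7\varepsilon\ell^{1/2}\le\frac12$ for small $\varepsilon$. And $\ell^{-3/2}\le8\varPhi$ on $S$,
because a square whose double meets $S$ has side below $4\ell$ (`side_lt_of_mem`,
`le_locPotential`). The number $L$ depends on the fields but enters only $\varepsilon_0$, so $C$ is
universal. -/

noncomputable section

namespace PauliDomination

/-! ### Geometry and measure of dyadic squares -/

namespace DyadicSquare

@[ext] theorem ext' {S T : DyadicSquare} (h : S.scale = T.scale) (h' : S.pos = T.pos) : S = T := by
  cases S; cases T; simp_all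

instance : Countable DyadicSquare := by
  have : Function.Injective (fun S : DyadicSquare => (S.scale, S.pos)) := by
    intro S T h
    simp only [Prod.mk.injEq] at h
    exact ext' h.1 h.2
  exact this.countable

theorem side_pos (S : DyadicSquare) : 0 < S.side := by unfold side; positivity

theorem mem_toSet {S : DyadicSquare} {x : Plane} :
    x ∈ S.toSet ↔ ∀ i, S.side * S.pos i ≤ x i ∧ x i ≤ S.side * (S.pos i + 1) := by
  refine forall_congr' fun i => ?_
  rw [abs_le, center]
  constructor
  · rintro ⟨h1, h2⟩; constructor <;> linarith
  · rintro ⟨h1, h2⟩; constructor <;> linarith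

/-- The half-open version of the square `S`. -/
def halfOpen (S : DyadicSquare) : Set Plane :=
  {x | ∀ i, S.side * S.pos i ≤ x i ∧ x i < S.side * (S.pos i + 1)}

theorem halfOpen_subset_toSet (S : DyadicSquare) : S.halfOpen ⊆ S.toSet :=
  fun _ hx => mem_toSet.2 fun i => ⟨(hx i).1, (hx i).2.le⟩

theorem dilate_mono (S : DyadicSquare) {t t' : ℝ} (h : t ≤ t') : S.dilate t ⊆ S.dilate t' := by
  intro _ hx i
  have := S.side_pos
  exact (hx i).trans (by gcongr)

theorem measurableSet_halfOpen (S : DyadicSquare) : MeasurableSet S.halfOpen := by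
  have h : S.halfOpen = ⋂ i, (fun x : Plane => x i) ⁻¹'
      Set.Ico (S.side * S.pos i) (S.side * (S.pos i + 1)) := by
    ext x; simp [halfOpen]
  rw [h]
  exact MeasurableSet.iInter fun i =>
    measurableSet_Ico.preimage (by fun_prop : Continuous fun x : Plane => x i).measurable

theorem isClosed_dilate (t : ℝ) (S : DyadicSquare) : IsClosed (S.dilate t) := by
  simp only [dilate, Set.ofPred_forall]
  exact isClosed_iInter fun i => isClosed_le (by fun_prop) continuous_const

/-- The half-open dyadic square of scale `k` containing `x`. -/
def containing (k : ℤ) (x : Plane) : DyadicSquare := ⟨k, fun i => ⌊x i / (2 : ℝ) ^ k⌋⟩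

theorem mem_halfOpen {S : DyadicSquare} {x : Plane} :
    x ∈ S.halfOpen ↔ S = containing S.scale x := by
  have hS := S.side_pos
  have h : ∀ i, (S.side * S.pos i ≤ x i ∧ x i < S.side * (S.pos i + 1)) ↔
      S.pos i = ⌊x i / (2 : ℝ) ^ S.scale⌋ := fun i => by
    rw [side] at hS ⊢
    rw [eq_comm (a := S.pos i), Int.floor_eq_iff, le_div_iff₀ hS, div_lt_iff₀ hS, mul_comm,
      mul_comm ((2 : ℝ) ^ S.scale)]
  constructor
  · exact fun hx => ext' rfl (funext fun i => (h i).1 (hx i))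
  · intro hx i
    exact (h i).2 (congrArg (fun T : DyadicSquare => T.pos i) hx)

theorem mem_halfOpen_containing (k : ℤ) (x : Plane) : x ∈ (containing k x).halfOpen :=
  mem_halfOpen.2 rfl

theorem corners_of_subset {S T : DyadicSquare} (h : S.toSet ⊆ T.toSet) (i : Fin 2) :
    T.side * T.pos i ≤ S.side * S.pos i ∧
      S.side * (S.pos i + 1) ≤ T.side * (T.pos i + 1) := by
  have hS := S.side_pos
  have h1 : (WithLp.toLp 2 fun i => S.side * S.pos i : Plane) ∈ S.toSet :=
    mem_toSet.2 fun i => ⟨le_rfl, by simp only; nlinarith⟩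
  have h2 : (WithLp.toLp 2 fun i => S.side * (S.pos i + 1) : Plane) ∈ S.toSet :=
    mem_toSet.2 fun i => ⟨by simp only; nlinarith, le_rfl⟩
  exact ⟨(mem_toSet.1 (h h1) i).1, (mem_toSet.1 (h h2) i).2⟩

theorem side_le_of_subset {S T : DyadicSquare} (h : S.toSet ⊆ T.toSet) : S.side ≤ T.side := by
  have := corners_of_subset h 0
  linarith

theorem side_le_side {S T : DyadicSquare} : S.side ≤ T.side ↔ S.scale ≤ T.scale :=
  zpow_le_zpow_iff_right₀ (by norm_num)

theorem halfOpen_subset_of_subset {S T : DyadicSquare} (h : S.toSet ⊆ T.toSet) :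
    S.halfOpen ⊆ T.halfOpen := fun _ hx i =>
  ⟨(corners_of_subset h i).1.trans (hx i).1, (hx i).2.trans_le (corners_of_subset h i).2⟩

theorem containing_subset {k k' : ℤ} (h : k ≤ k') (x : Plane) :
    (containing k x).toSet ⊆ (containing k' x).toSet := by
  obtain ⟨n, rfl⟩ := Int.le.dest h
  have hside : (containing (k + n) x).side = (containing k x).side * 2 ^ n := by
    simp [side, containing, zpow_add₀]
  have hk := (containing k x).side_pos
  intro y hy
  rw [mem_toSet] at hy ⊢
  intro i
  have hx := mem_halfOpen_containing k x i
  have hx' := mem_halfOpen_containing (k + n) x i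
  rw [hside] at hx' ⊢
  set m := (containing k x).pos i
  set m' := (containing (k + n) x).pos i
  set l := (containing k x).side
  -- Both half-open squares contain `x`, which gives strict inequalities between corners;
  -- integrality sharpens them to the nesting of the closed squares.
  have e1 : (2 ^ n * m' : ℝ) < m + 1 := by
    by_contra! hc
    nlinarith [hx.2, hx'.1]
  have e2 : (m : ℝ) < 2 ^ n * (m' + 1) := by
    by_contra! hc
    nlinarith [hx.1, hx'.2]
  have f1 : 2 ^ n * m' ≤ m := by
    have : (2 ^ n * m' : ℤ) < m + 1 := by exact_mod_cast e1
    omega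
  have f2 : m + 1 ≤ 2 ^ n * (m' + 1) := by
    have : (m : ℤ) < 2 ^ n * (m' + 1) := by exact_mod_cast e2
    omega
  have g1 : (2 ^ n * m' : ℝ) ≤ m := by exact_mod_cast f1
  have g2 : (m + 1 : ℝ) ≤ 2 ^ n * (m' + 1) := by exact_mod_cast f2
  constructor
  · nlinarith [(hy i).1]
  · nlinarith [(hy i).2]

theorem containing_ssubset {k k' : ℤ} (h : k < k') (x : Plane) :
    (containing k x).toSet ⊂ (containing k' x).toSet :=
  ⟨containing_subset h.le x, fun hc => absurd (side_le_side.1 (side_le_of_subset hc)) h.not_ge⟩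

/-- If `x` lies in `2T` and `T` is at least four times as large as `S`, then the
twelvefold dilate of the square around `x` of twice the size of `S` is contained in that of `T`. -/
theorem dilate_parent_subset {S T : DyadicSquare} {x : Plane} (hxT : x ∈ T.dilate 2) (h : 4 * S.side ≤ T.side) :
    (containing (S.scale + 1) x).dilate 12 ⊆ T.dilate 12 := by
  intro y hy i
  have h1 := halfOpen_subset_toSet _ (mem_halfOpen_containing (S.scale + 1) x) i
  have h2 := hy i
  have h3 := hxT i
  have hs : (containing (S.scale + 1) x).side = 2 * S.side := by
    simp [side, containing, zpow_add₀, mul_comm]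
  have := S.side_pos
  rw [hs] at h1 h2
  rw [abs_le] at *
  -- With $\ell$ the side of `S`, each coordinate of `y` is within $12\ell+\ell+\ell(T)$ of the
  -- center of `T`, and $13\ell\le5\ell(T)$.
  constructor <;> linarith

theorem dilate_subset_closedBall {S : DyadicSquare} {x : Plane} (hx : x ∈ S.dilate 12) :
    S.dilate 12 ⊆ Metric.closedBall x (24 * S.side) := by
  intro y hy
  have := S.side_pos
  rw [Metric.mem_closedBall, EuclideanSpace.dist_eq]
  apply Real.sqrt_le_iff.2 ⟨by positivity, ?_⟩
  have h : ∀ i, dist (y i) (x i) ^ 2 ≤ (12 * S.side) ^ 2 := fun i => by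
    apply pow_le_pow_left₀ dist_nonneg
    rw [Real.dist_eq]
    have h1 := hx i
    have h2 := hy i
    rw [abs_le] at *
    constructor <;> linarith
  rw [Fin.sum_univ_two]
  nlinarith [h 0, h 1]

theorem isCompact_dilate (S : DyadicSquare) : IsCompact (S.dilate 12) := by
  refine (isCompact_closedBall (WithLp.toLp 2 S.center : Plane) (24 * S.side)).of_isClosed_subset
    (S.isClosed_dilate 12) (dilate_subset_closedBall fun i => ?_)
  have := S.side_pos
  simp only [sub_self, abs_zero]
  positivity

/-- Coordinates as a measure preserving map to `ℝ × ℝ`. -/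
def planeEquivProd : Plane ≃ᵐ ℝ × ℝ :=
  (MeasurableEquiv.toLp 2 (Fin 2 → ℝ)).symm.trans MeasurableEquiv.finTwoArrow

theorem planeEquivProd_apply (x : Plane) : planeEquivProd x = (x 0, x 1) := rfl

theorem measurePreserving_planeEquivProd : MeasurePreserving planeEquivProd volume volume :=
  (volume_preserving_finTwoArrow ℝ).comp
    (EuclideanSpace.volume_preserving_symm_measurableEquiv_toLp (Fin 2))

/-- The `i`-th side of `S` as an interval. -/
def interval (S : DyadicSquare) (i : Fin 2) : Set ℝ :=
  Set.Ico (S.side * S.pos i) (S.side * (S.pos i + 1))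

theorem measurableSet_interval (S : DyadicSquare) (i : Fin 2) : MeasurableSet (S.interval i) :=
  measurableSet_Ico

theorem volume_interval (S : DyadicSquare) (i : Fin 2) :
    volume (S.interval i) = ENNReal.ofReal S.side := by
  rw [interval, Real.volume_Ico]; congr 1; ring

theorem halfOpen_eq_preimage (S : DyadicSquare) :
    S.halfOpen = planeEquivProd ⁻¹' (S.interval 0 ×ˢ S.interval 1) := by
  ext x
  simp [halfOpen, planeEquivProd_apply, interval, Fin.forall_fin_two]

/-- Product form of the integral, which lets Tonelli be used in the Sobolev inequality. -/
theorem lintegral_halfOpen (S : DyadicSquare) (F : Plane → ℝ≥0∞) :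
    ∫⁻ x in S.halfOpen, F x =
      ∫⁻ z, F (planeEquivProd.symm z)
        ∂((volume.restrict (S.interval 0)).prod (volume.restrict (S.interval 1))) := by
  rw [Measure.prod_restrict, halfOpen_eq_preimage, ← Measure.volume_eq_prod,
    ← measurePreserving_planeEquivProd.setLIntegral_comp_preimage_emb
      planeEquivProd.measurableEmbedding]
  simp

theorem volume_halfOpen (S : DyadicSquare) : volume S.halfOpen = ENNReal.ofReal (S.side ^ 2) := by
  have h := lintegral_halfOpen S fun _ => 1
  rw [setLIntegral_one] at h
  rw [h, lintegral_one, ← Set.univ_prod_univ, Measure.prod_prod, Measure.restrict_apply_univ,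
    Measure.restrict_apply_univ, volume_interval, volume_interval,
    ← ENNReal.ofReal_mul S.side_pos.le, sq]

end DyadicSquare

/-! ### Sobolev inequalities on a square and the relative bound for a potential in $L^{4/3}$ -/

/-- The fundamental theorem of calculus between `t` and `x`, averaged over `t` in the interval. -/
theorem enorm_le_lintegral_Ico {h h' : ℝ → ℝ} (hd : ∀ t, HasDerivAt h (h' t) t)
    (hc : Continuous h') {c d x : ℝ} (hcd : c < d) (hx : x ∈ Set.Ico c d) :
    ‖h x‖ₑ ≤ ∫⁻ t in Set.Ico c d, (‖h' t‖ₑ + ENNReal.ofReal (d - c)⁻¹ * ‖h t‖ₑ) := by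
  have hcont : Continuous h := continuous_iff_continuousAt.2 fun t => (hd t).continuousAt
  have key : ∀ t ∈ Set.Ico c d, ‖h x‖ₑ ≤ ‖h t‖ₑ + ∫⁻ t in Set.Ico c d, ‖h' t‖ₑ := by
    intro t ht
    have h1 : h x = h t + ∫ y in t..x, h' y := by
      rw [intervalIntegral.integral_eq_sub_of_hasDerivAt (fun y _ => hd y)
        (hc.intervalIntegrable _ _)]; ring
    have h2 : ‖∫ y in t..x, h' y‖ₑ ≤ ∫⁻ t in Set.Ico c d, ‖h' t‖ₑ := by
      have : ‖∫ y in t..x, h' y‖ₑ = ‖∫ y in Set.uIoc t x, h' y‖ₑ := by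
        rw [← ofReal_norm, ← ofReal_norm,
          intervalIntegral.norm_intervalIntegral_eq]
      rw [this]
      refine (enorm_integral_le_lintegral_enorm _).trans (lintegral_mono_set ?_)
      intro y hy
      rw [Set.uIoc, Set.mem_Ioc] at hy
      exact ⟨(le_inf ht.1 hx.1).trans hy.1.le, hy.2.trans_lt (sup_lt_iff.2 ⟨ht.2, hx.2⟩)⟩
    calc ‖h x‖ₑ ≤ ‖h t‖ₑ + ‖∫ y in t..x, h' y‖ₑ := by rw [h1]; exact enorm_add_le _ _
      _ ≤ _ := by gcongr
  have hint : ∫⁻ t in Set.Ico c d, ‖h x‖ₑ ≤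
      ∫⁻ t in Set.Ico c d, (‖h t‖ₑ + ∫⁻ t in Set.Ico c d, ‖h' t‖ₑ) :=
    setLIntegral_mono' measurableSet_Ico key
  rw [lintegral_add_right _ measurable_const, setLIntegral_const, setLIntegral_const,
    Real.volume_Ico] at hint
  have hpos : 0 < d - c := sub_pos.2 hcd
  have hinv : ENNReal.ofReal (d - c)⁻¹ * ENNReal.ofReal (d - c) = 1 := by
    rw [← ENNReal.ofReal_mul (inv_pos.2 hpos).le, inv_mul_cancel₀ hpos.ne', ENNReal.ofReal_one]
  rw [lintegral_add_right _ (hcont.enorm.measurable.const_mul _),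
    lintegral_const_mul _ hcont.enorm.measurable]
  calc ‖h x‖ₑ = ENNReal.ofReal (d - c)⁻¹ * (‖h x‖ₑ * ENNReal.ofReal (d - c)) := by
        rw [mul_comm ‖h x‖ₑ, ← mul_assoc, hinv, one_mul]
    _ ≤ ENNReal.ofReal (d - c)⁻¹ * ((∫⁻ t in Set.Ico c d, ‖h t‖ₑ) +
          (∫⁻ t in Set.Ico c d, ‖h' t‖ₑ) * ENNReal.ofReal (d - c)) := by gcongr
    _ = _ := by
        rw [mul_add, add_comm, mul_comm (lintegral _ _) (ENNReal.ofReal _), ← mul_assoc, hinv,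
          one_mul]

theorem planeEquivProd_symm_apply (z : ℝ × ℝ) : DyadicSquare.planeEquivProd.symm z =
    z.1 • EuclideanSpace.single 0 (1 : ℝ) + z.2 • EuclideanSpace.single 1 (1 : ℝ) := by
  rw [MeasurableEquiv.symm_apply_eq, DyadicSquare.planeEquivProd_apply]
  simp

theorem continuous_partialDeriv {F : Type} [NormedAddCommGroup F] [NormedSpace ℝ F]
    {v : Plane → F} (hv : ContDiff ℝ 1 v) (i : Fin 2) : Continuous (partialDeriv i v) :=
  (hv.continuous_fderiv one_ne_zero).clm_apply continuous_const

/-- The two-dimensional Sobolev inequality `W^{1,1} ⊂ L²` on a dyadic square. -/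
theorem lintegral_sq_halfOpen_le {v : Plane → ℝ} (hv : ContDiff ℝ 1 v) (S : DyadicSquare) :
    ∫⁻ x in S.halfOpen, ‖v x‖ₑ ^ 2 ≤
      (∫⁻ x in S.halfOpen, (‖partialDeriv 0 v x‖ₑ + ENNReal.ofReal S.side⁻¹ * ‖v x‖ₑ)) *
      ∫⁻ x in S.halfOpen, (‖partialDeriv 1 v x‖ₑ + ENNReal.ofReal S.side⁻¹ * ‖v x‖ₑ) := by
  set e := DyadicSquare.planeEquivProd with he
  have hdiff : ∀ x, HasFDerivAt v (fderiv ℝ v x) x := fun x =>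
    (hv.differentiable one_ne_zero x).hasFDerivAt
  have hS := S.side_pos
  have hside : ∀ i, S.side * (S.pos i + 1) - S.side * S.pos i = S.side := fun i => by ring
  have hlt : ∀ i, S.side * S.pos i < S.side * (S.pos i + 1) := fun i => by linarith [hside i]
  have hcontS : Continuous fun z : ℝ × ℝ => e.symm z := by
    simp only [he, planeEquivProd_symm_apply]; fun_prop
  have hcontH : ∀ i, Continuous fun z : ℝ × ℝ =>
      ‖partialDeriv i v (e.symm z)‖ₑ + ENNReal.ofReal S.side⁻¹ * ‖v (e.symm z)‖ₑ := fun i =>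
    ((continuous_partialDeriv hv i).comp hcontS).enorm.add
      ((ENNReal.continuous_const_mul ENNReal.ofReal_ne_top).comp
        (hv.continuous.comp hcontS).enorm)
  rw [S.lintegral_halfOpen, S.lintegral_halfOpen, S.lintegral_halfOpen]
  -- Gagliardo's argument: the horizontal line integral through $(s,t)$ depends only on $t$ and the
  -- vertical one only on $s$. By Tonelli the right-hand side is the double integral of their
  -- product, so a pointwise bound suffices.
  rw [lintegral_prod_symm _ (hcontH 0).measurable.aemeasurable,
    lintegral_prod _ (hcontH 1).measurable.aemeasurable, mul_comm,
    ← lintegral_prod_mul (hcontH 1).measurable.lintegral_prod_right'.aemeasurable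
      (hcontH 0).measurable.lintegral_prod_left'.aemeasurable, Measure.prod_restrict]
  refine setLIntegral_mono' ((S.measurableSet_interval 0).prod (S.measurableSet_interval 1)) ?_
  rintro ⟨s, t⟩ ⟨hs, ht⟩
  have h0 : ∀ r, HasDerivAt (fun r => v (e.symm (r, t))) (partialDeriv 0 v (e.symm (r, t))) r := by
    intro r
    refine (hdiff _).comp_hasDerivAt r ?_
    simp only [he, planeEquivProd_symm_apply]
    simpa using ((hasDerivAt_id r).smul_const (EuclideanSpace.single (0 : Fin 2) (1 : ℝ))).add_const
      (t • EuclideanSpace.single (1 : Fin 2) (1 : ℝ))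
  have h1 : ∀ r, HasDerivAt (fun r => v (e.symm (s, r))) (partialDeriv 1 v (e.symm (s, r))) r := by
    intro r
    refine (hdiff _).comp_hasDerivAt r ?_
    simp only [he, planeEquivProd_symm_apply]
    simpa using ((hasDerivAt_id r).smul_const (EuclideanSpace.single (1 : Fin 2) (1 : ℝ))).const_add
      (s • EuclideanSpace.single (0 : Fin 2) (1 : ℝ))
  have b0 := enorm_le_lintegral_Ico h0 (((continuous_partialDeriv hv 0).comp hcontS).comp
    (by fun_prop : Continuous fun r : ℝ => (r, t))) (hlt 0) hs
  have b1 := enorm_le_lintegral_Ico h1 (((continuous_partialDeriv hv 1).comp hcontS).comp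
    (by fun_prop : Continuous fun r : ℝ => (s, r))) (hlt 1) ht
  rw [hside] at b0 b1
  rw [sq]
  exact mul_le_mul' b1 b0

/-- The algebraic step from the Sobolev inequalities for the second and fourth powers to the
bound on the `L⁸` norm. -/
theorem sqrt_le_of_sobolev {x y a D l : ℝ}
    (hl : 0 < l) (h1 : y ^ 2 ≤ 2 * (a * D) + l⁻¹ * a ^ 2)
    (h2 : x ^ 2 ≤ 4 * (x * y * D) + l⁻¹ * y ^ 4) :
    x ≤ 7 * (l ^ (1 / 2 : ℝ) * (D ^ 2 + l⁻¹ ^ 2 * a ^ 2)) := by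
  set N := D ^ 2 + l⁻¹ ^ 2 * a ^ 2 with hN
  have hN0 : 0 ≤ N := by positivity
  have hy2 : y ^ 2 ≤ 2 * l * N := by
    have e : 2 * l * N - (2 * (a * D) + l⁻¹ * a ^ 2) = l * ((D - l⁻¹ * a) ^ 2 + D ^ 2) := by
      rw [hN]; field_simp; ring
    have : 0 ≤ l * ((D - l⁻¹ * a) ^ 2 + D ^ 2) := by positivity
    linarith
  have hDN : D ^ 2 ≤ N := by rw [hN]; nlinarith [sq_nonneg (l⁻¹ * a)]
  have hx2 : x ^ 2 ≤ 49 * (l * N ^ 2) := by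
    -- Young's inequality absorbs half of $x^2$. What remains is $x^2\le2(16+4)\,lN^2=40\,lN^2$,
    -- rounded up to $7^2lN^2$.
    have e1 : 4 * (x * y * D) ≤ x ^ 2 / 2 + 8 * (y ^ 2 * D ^ 2) := by
      nlinarith [sq_nonneg (x - 4 * (y * D))]
    have e2 : y ^ 2 * D ^ 2 ≤ 2 * l * N * N := by gcongr
    have e3 : l⁻¹ * y ^ 4 ≤ 4 * (l * N ^ 2) := by
      calc l⁻¹ * y ^ 4 = l⁻¹ * (y ^ 2) ^ 2 := by ring
        _ ≤ l⁻¹ * (2 * l * N) ^ 2 := by gcongr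
        _ = 4 * (l * N ^ 2) := by field_simp; ring
    have : 0 ≤ l * N ^ 2 := by positivity
    nlinarith
  have hr : (l ^ (1 / 2 : ℝ)) ^ 2 = l := by
    rw [← Real.rpow_natCast, ← Real.rpow_mul hl.le]; norm_num
  refine le_of_sq_le_sq ?_ (by positivity)
  calc x ^ 2 ≤ 49 * (l * N ^ 2) := hx2
    _ = _ := by rw [mul_pow, mul_pow, hr]; norm_num

theorem lintegral_mul_le_of_sq {α : Type*} [MeasurableSpace α] {μ : Measure α} {f g : α → ℝ≥0∞}
    (hf : AEMeasurable f μ) (hg : AEMeasurable g μ) {c d : ℝ≥0∞} (hc : ∫⁻ x, f x ^ 2 ∂μ ≤ c ^ 2)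
    (hd : ∫⁻ x, g x ^ 2 ∂μ ≤ d ^ 2) : ∫⁻ x, f x * g x ∂μ ≤ c * d := by
  have h := ENNReal.lintegral_mul_le_Lp_mul_Lq μ Real.HolderConjugate.two_two hf hg
  have hr : ∀ {t s : ℝ≥0∞}, t ≤ s ^ 2 → t ^ (1 / 2 : ℝ) ≤ s := fun {t s} hts => by
    calc t ^ (1 / 2 : ℝ) ≤ (s ^ 2) ^ (1 / 2 : ℝ) := by gcongr
      _ = s := by
        rw [← ENNReal.rpow_natCast, ← ENNReal.rpow_mul]; norm_num
  refine h.trans (mul_le_mul' (hr ?_) (hr ?_))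
  · simpa using hc
  · simpa using hd

theorem exists_ofReal_pow_eq {t : ℝ≥0∞} (ht : t ≠ ⊤) {n : ℕ} (hn : n ≠ 0) :
    ∃ r : ℝ, 0 ≤ r ∧ t = ENNReal.ofReal r ^ n := by
  refine ⟨t.toReal ^ (1 / n : ℝ), by positivity, ?_⟩
  rw [← ENNReal.ofReal_pow (by positivity), one_div, Real.rpow_inv_natCast_pow (by positivity) hn,
    ENNReal.ofReal_toReal ht]

theorem lintegral_halfOpen_pow_ne_top {w : Plane → ℝ} (hw : Continuous w) (S : DyadicSquare)
    (n : ℕ) : ∫⁻ x in S.halfOpen, ‖w x‖ₑ ^ n ≠ ⊤ := by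
  have h : IntegrableOn (fun x => w x ^ n) S.halfOpen :=
    ((hw.pow n).continuousOn.integrableOn_compact S.isCompact_dilate).mono_set
      (S.halfOpen_subset_toSet.trans (S.dilate_mono (by norm_num)))
  have := h.2
  simp only [HasFiniteIntegral, enorm_pow] at this
  exact this.ne

/-- A function `B` in `L^{4/3}` of a square, as a potential, is bounded relative to the Dirichlet
energy. The square `w` of the amplitude `U` is assumed to be smooth, with `∇w` controlled by
`U` times the energy density. -/
theorem lintegral_halfOpen_mul_sq_le {w : Plane → ℝ} (hw : ContDiff ℝ 1 w) (S : DyadicSquare)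
    {U : Plane → ℝ≥0∞} (hU : Measurable U) (hUw : ∀ x, ‖w x‖ₑ = U x ^ 2)
    {G : Fin 2 → Plane → ℝ≥0∞} (hG : ∀ i, AEMeasurable (G i) volume)
    (hGw : ∀ i x, ‖partialDeriv i w x‖ₑ ≤ 2 * (U x * G i x))
    (hfin : ∫⁻ x in S.halfOpen, ∑ i, G i x ^ 2 ≠ ⊤)
    {B : Plane → ℝ} (hB : AEStronglyMeasurable B volume) :
    ∫⁻ x in S.halfOpen, ‖B x‖ₑ * U x ^ 2 ≤
      eLpNorm B (ENNReal.ofReal (4 / 3)) (volume.restrict S.halfOpen) *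
      (7 * (ENNReal.ofReal (S.side ^ (1 / 2 : ℝ)) * (∫⁻ x in S.halfOpen, ∑ i, G i x ^ 2) +
        ENNReal.ofReal (S.side ^ (1 / 2 : ℝ) * S.side⁻¹ ^ 2) * ∫⁻ x in S.halfOpen, U x ^ 2)) := by
  set μ := volume.restrict S.halfOpen with hμ
  have hl := S.side_pos
  have hU1 : AEMeasurable U μ := hU.aemeasurable
  have hG1 : ∀ i, AEMeasurable (G i) μ := fun i => (hG i).restrict
  have hU2 : ∫⁻ x, U x ^ 2 ∂μ = ∫⁻ x, ‖w x‖ₑ ^ 1 ∂μ := by simp [hUw]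
  have hU4 : ∫⁻ x, U x ^ 4 ∂μ = ∫⁻ x, ‖w x‖ₑ ^ 2 ∂μ := by simp [hUw, ← pow_mul]
  have hU8 : ∫⁻ x, U x ^ 8 ∂μ = ∫⁻ x, ‖w x‖ₑ ^ 4 ∂μ := by simp [hUw, ← pow_mul]
  -- Here $a=\|U\|_2$ and $y=\|U\|_4$, but $x=\|U\|_8^2=\|U^2\|_4$, the factor that Hölder against
  -- $L^{4/3}$ produces. Finiteness matters because $x$ occurs on both sides of the second Sobolev
  -- inequality.
  obtain ⟨a, ha, ha'⟩ := exists_ofReal_pow_eq (t := ∫⁻ x, U x ^ 2 ∂μ)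
    (by rw [hU2]; exact lintegral_halfOpen_pow_ne_top hw.continuous S 1) two_ne_zero
  obtain ⟨y, hy, hy'⟩ := exists_ofReal_pow_eq (t := ∫⁻ x, U x ^ 4 ∂μ)
    (by rw [hU4]; exact lintegral_halfOpen_pow_ne_top hw.continuous S 2) four_ne_zero
  obtain ⟨x, hx, hx'⟩ := exists_ofReal_pow_eq (t := ∫⁻ x, U x ^ 8 ∂μ)
    (by rw [hU8]; exact lintegral_halfOpen_pow_ne_top hw.continuous S 4) four_ne_zero
  obtain ⟨D, hD, hD'⟩ := exists_ofReal_pow_eq hfin two_ne_zero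
  have hGD : ∀ i, ∫⁻ x, G i x ^ 2 ∂μ ≤ ENNReal.ofReal D ^ 2 := fun i => by
    rw [← hD']
    exact lintegral_mono fun z =>
      Finset.single_le_sum (f := fun j => G j z ^ 2) (fun _ _ => zero_le) (Finset.mem_univ i)
  have c1 : ∀ i, ∫⁻ z, U z * G i z ∂μ ≤ ENNReal.ofReal a * ENNReal.ofReal D := fun i =>
    lintegral_mul_le_of_sq hU1 (hG1 i) ha'.le (hGD i)
  -- Cauchy–Schwarz for $U^6=U^4\cdot U^2$.
  have c6 : ∫⁻ z, (U z ^ 3) ^ 2 ∂μ ≤ (ENNReal.ofReal x * ENNReal.ofReal y) ^ 2 := by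
    have h := lintegral_mul_le_of_sq (μ := μ) (f := fun z => U z ^ 4) (g := fun z => U z ^ 2)
      (c := ENNReal.ofReal x ^ 2) (d := ENNReal.ofReal y ^ 2)
      (by fun_prop) (by fun_prop) (by simp only [← pow_mul]; exact hx'.le)
      (by simp only [← pow_mul]; exact hy'.le)
    rw [mul_pow]
    refine le_trans (le_of_eq ?_) h
    congr 1; ext z; ring
  have c3 : ∀ i, ∫⁻ z, U z ^ 3 * G i z ∂μ ≤
      ENNReal.ofReal x * ENNReal.ofReal y * ENNReal.ofReal D := fun i =>
    lintegral_mul_le_of_sq (by fun_prop) (hG1 i) c6 (hGD i)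
  have m1 : ∀ i, ∫⁻ z, (‖partialDeriv i w z‖ₑ + ENNReal.ofReal S.side⁻¹ * ‖w z‖ₑ) ∂μ ≤
      ENNReal.ofReal (2 * (a * D) + S.side⁻¹ * a ^ 2) := fun i => by
    calc _ ≤ ∫⁻ z, (2 * (U z * G i z) + ENNReal.ofReal S.side⁻¹ * U z ^ 2) ∂μ :=
          lintegral_mono fun z => add_le_add (hGw i z) (by rw [hUw])
      _ = 2 * ∫⁻ z, U z * G i z ∂μ + ENNReal.ofReal S.side⁻¹ * ∫⁻ z, U z ^ 2 ∂μ := by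
          rw [lintegral_add_right _ (by fun_prop), lintegral_const_mul' _ _ ENNReal.ofNat_ne_top,
            lintegral_const_mul _ (by fun_prop)]
      _ ≤ 2 * (ENNReal.ofReal a * ENNReal.ofReal D) +
            ENNReal.ofReal S.side⁻¹ * ENNReal.ofReal a ^ 2 := by
          rw [ha']; gcongr; exact c1 i
      _ = _ := by
          rw [ENNReal.ofReal_add (by positivity) (by positivity), ENNReal.ofReal_mul (by norm_num),
            ENNReal.ofReal_mul ha, ENNReal.ofReal_mul (by positivity), ENNReal.ofReal_pow ha]
          norm_num
  have hpw : ∀ i z, partialDeriv i (fun z => w z ^ 2) z = 2 * w z * partialDeriv i w z :=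
    fun i z => by
      have := ((hw.differentiable one_ne_zero z).hasFDerivAt.pow 2).fderiv
      simp only [partialDeriv, this]
      simp
  have m2 : ∀ i, ∫⁻ z, (‖partialDeriv i (fun z => w z ^ 2) z‖ₑ +
      ENNReal.ofReal S.side⁻¹ * ‖w z ^ 2‖ₑ) ∂μ ≤
      ENNReal.ofReal (4 * (x * y * D) + S.side⁻¹ * y ^ 4) := fun i => by
    calc _ ≤ ∫⁻ z, (4 * (U z ^ 3 * G i z) + ENNReal.ofReal S.side⁻¹ * U z ^ 4) ∂μ := by
          refine lintegral_mono fun z => add_le_add ?_ ?_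
          · rw [hpw, enorm_mul, enorm_mul, hUw]
            calc _ ≤ ‖(2 : ℝ)‖ₑ * U z ^ 2 * (2 * (U z * G i z)) := by gcongr; exact hGw i z
              _ = 2 * 2 * (U z ^ 3 * G i z) := by
                have : ‖(2 : ℝ)‖ₑ = 2 := by simp [Real.enorm_eq_ofReal]
                rw [this]; ring
              _ = _ := by norm_num
          · rw [enorm_pow, hUw, ← pow_mul]
      _ = 4 * ∫⁻ z, U z ^ 3 * G i z ∂μ + ENNReal.ofReal S.side⁻¹ * ∫⁻ z, U z ^ 4 ∂μ := by
          rw [lintegral_add_right _ (by fun_prop), lintegral_const_mul' _ _ ENNReal.ofNat_ne_top,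
            lintegral_const_mul _ (by fun_prop)]
      _ ≤ 4 * (ENNReal.ofReal x * ENNReal.ofReal y * ENNReal.ofReal D) +
            ENNReal.ofReal S.side⁻¹ * ENNReal.ofReal y ^ 4 := by
          rw [hy']; gcongr; exact c3 i
      _ = _ := by
          rw [ENNReal.ofReal_add (by positivity) (by positivity), ENNReal.ofReal_mul (by norm_num),
            ENNReal.ofReal_mul (by positivity), ENNReal.ofReal_mul hx,
            ENNReal.ofReal_mul (by positivity), ENNReal.ofReal_pow hy]
          norm_num
  have r1 : y ^ 2 ≤ 2 * (a * D) + S.side⁻¹ * a ^ 2 := by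
    have h := (lintegral_sq_halfOpen_le hw S).trans (mul_le_mul' (m1 0) (m1 1))
    rw [← hU4, hy', ← ENNReal.ofReal_pow hy, ← ENNReal.ofReal_mul (by positivity),
      ENNReal.ofReal_le_ofReal_iff (by positivity)] at h
    exact le_of_sq_le_sq (by linarith) (by positivity)
  have r2 : x ^ 2 ≤ 4 * (x * y * D) + S.side⁻¹ * y ^ 4 := by
    have h := (lintegral_sq_halfOpen_le (hw.pow 2) S).trans (mul_le_mul' (m2 0) (m2 1))
    simp only [enorm_pow, ← pow_mul] at h
    rw [← hU8, hx', ← ENNReal.ofReal_pow hx, ← ENNReal.ofReal_mul (by positivity),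
      ENNReal.ofReal_le_ofReal_iff (by positivity)] at h
    exact le_of_sq_le_sq (by linarith) (by positivity)
  have r3 := sqrt_le_of_sobolev hl r1 r2
  have hol : (4 / 3 : ℝ).HolderConjugate 4 := by
    rw [Real.holderConjugate_iff]; norm_num
  have h := ENNReal.lintegral_mul_le_Lp_mul_Lq μ hol (f := fun z => ‖B z‖ₑ)
    (g := fun z => U z ^ 2) hB.restrict.enorm (by fun_prop)
  refine h.trans (mul_le_mul' (le_of_eq ?_) ?_)
  · rw [eLpNorm_eq_lintegral_rpow_enorm_toReal (by simp) ENNReal.ofReal_ne_top,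
      ENNReal.toReal_ofReal (by norm_num)]
  · have e1 : ∀ z, (U z ^ 2) ^ (4 : ℝ) = U z ^ 8 := fun z => by
      rw [← ENNReal.rpow_natCast, ← ENNReal.rpow_mul, ← ENNReal.rpow_natCast]; norm_num
    have e2 : (ENNReal.ofReal x ^ 4) ^ (1 / 4 : ℝ) = ENNReal.ofReal x := by
      rw [← ENNReal.rpow_natCast, ← ENNReal.rpow_mul]; norm_num
    simp only [e1]
    rw [hx', e2, ha', hD']
    refine (ENNReal.ofReal_le_ofReal r3).trans (le_of_eq ?_)
    rw [ENNReal.ofReal_mul (by norm_num), mul_add, ← mul_assoc,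
      ENNReal.ofReal_add (by positivity) (by positivity), ENNReal.ofReal_mul (by positivity),
      ENNReal.ofReal_mul (by positivity), ENNReal.ofReal_pow hD, ENNReal.ofReal_pow ha]
    norm_num

/-! ### Local integrability -/

theorem LocMemLp.locallyIntegrable {F : Type} [NormedAddCommGroup F] {f : Plane → F} {p : ℝ≥0∞}
    (hf : LocMemLp f p) (hp : 1 ≤ p) : LocallyIntegrable f := by
  refine locallyIntegrable_iff.2 fun K hK => ?_
  have : IsFiniteMeasure (volume.restrict K) := isFiniteMeasure_restrict.2 hK.measure_lt_top.ne
  exact (hf K hK).integrable hp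

theorem integrable_mul_of_locallyIntegrable {b η : Plane → ℝ}
    (hb : LocallyIntegrable b) (hη : Continuous η) (hs : HasCompactSupport η) :
    Integrable fun x => b x * η x :=
  hb.integrable_smul_right_of_hasCompactSupport hη hs

theorem LocMemLp.coord_locallyIntegrable {a : Plane → Plane} (ha : LocMemLp a 2) (i : Fin 2) :
    LocallyIntegrable fun x => a x i := by
  refine (ha.locallyIntegrable (by norm_num)).mono ?_ (.of_forall fun x => PiLp.norm_apply_le _ i)
  exact (by fun_prop : Continuous fun x : Plane => x i).comp_aestronglyMeasurable
    (ha.locallyIntegrable (by norm_num)).aestronglyMeasurable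

theorem HasCompactSupport.partialDeriv {F : Type} [NormedAddCommGroup F] [NormedSpace ℝ F]
    {f : Plane → F} (hf : HasCompactSupport f) (i : Fin 2) :
    HasCompactSupport (partialDeriv i f) :=
  hf.fderiv_apply (𝕜 := ℝ) _

theorem integral_mul_partialDeriv {f g : Plane → ℝ} (hf : ContDiff ℝ 1 f) (hg : ContDiff ℝ 1 g)
    (hs : HasCompactSupport g) (i : Fin 2) :
    ∫ x, f x * partialDeriv i g x = -∫ x, partialDeriv i f x * g x := by
  refine integral_mul_fderiv_eq_neg_fderiv_mul_of_integrable ?_ ?_ ?_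
    (fun x _ => hf.differentiable one_ne_zero x) (fun x _ => hg.differentiable one_ne_zero x)
  · exact ((continuous_partialDeriv hf i).mul hg.continuous).integrable_of_hasCompactSupport
      hs.mul_left
  · exact (hf.continuous.mul (continuous_partialDeriv hg i)).integrable_of_hasCompactSupport
      (HasCompactSupport.partialDeriv hs i).mul_left
  · exact (hf.continuous.mul hg.continuous).integrable_of_hasCompactSupport hs.mul_left

theorem contDiff_partialDeriv {f : Plane → ℝ} (hf : ContDiff ℝ ∞ f) (i : Fin 2) :
    ContDiff ℝ ∞ (partialDeriv i f) :=
  (hf.fderiv_right (by simp)).clm_apply contDiff_const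

theorem partialDeriv_comm {f : Plane → ℝ} (hf : ContDiff ℝ ∞ f) (i j : Fin 2) (x : Plane) :
    partialDeriv i (partialDeriv j f) x = partialDeriv j (partialDeriv i f) x := by
  have hd : DifferentiableAt ℝ (fderiv ℝ f) x :=
    (hf.fderiv_right (m := ∞) (by simp)).differentiable (by simp) x
  have h : ∀ i j, partialDeriv i (partialDeriv j f) x =
      fderiv ℝ (fderiv ℝ f) x (EuclideanSpace.single i 1) (EuclideanSpace.single j 1) :=
    fun i j => by
      have := (hd.hasFDerivAt.clm_apply
        (hasFDerivAt_const (EuclideanSpace.single j (1 : ℝ)) x)).fderiv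
      unfold partialDeriv
      rw [this]; simp
  rw [h, h]
  exact (hf.contDiffAt.isSymmSndFDerivAt (by
    rw [minSmoothness_of_isRCLikeNormedField]; exact WithTop.coe_le_coe.2 le_top)) _ _

/-- The Jacobian determinant of a compactly supported pair of functions has zero integral. -/
theorem integral_jacobian_eq_zero {f g : Plane → ℝ} (hf : ContDiff ℝ ∞ f) (hg : ContDiff ℝ ∞ g)
    (hfs : HasCompactSupport f) :
    ∫ x, (partialDeriv 0 f x * partialDeriv 1 g x - partialDeriv 1 f x * partialDeriv 0 g x) =
      0 := by
  have hi : ∀ i j, Integrable fun x => partialDeriv i f x * partialDeriv j g x := fun i j =>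
    ((contDiff_partialDeriv hf i).continuous.mul
      (contDiff_partialDeriv hg j).continuous).integrable_of_hasCompactSupport
      (HasCompactSupport.partialDeriv hfs i).mul_right
  have h : ∀ i j, ∫ x, partialDeriv i f x * partialDeriv j g x =
      -∫ x, partialDeriv i (partialDeriv j g) x * f x := fun i j => by
    rw [← integral_mul_partialDeriv ((contDiff_partialDeriv hg j).of_le (by simp))
      (hf.of_le (by simp)) hfs]
    simp only [mul_comm]
  rw [integral_sub (hi 0 1) (hi 1 0), h, h]
  simp only [partialDeriv_comm hg 0 1, sub_self]

/-! ### The total field -/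

theorem isDistribCurl_extPotential (c : ℝ) : IsDistribCurl (extPotential c) fun _ => c := by
  intro η hη hs
  have hη1 : ContDiff ℝ 1 η := hη.of_le (by simp)
  have h : ∀ i : Fin 2, ∫ x : Plane, x i * partialDeriv i η x = -∫ x, η x := fun i => by
    rw [integral_mul_partialDeriv (by fun_prop) hη1 hs]
    congr 2; ext x
    have : partialDeriv i (fun x : Plane => x i) x = 1 := by
      have := (EuclideanSpace.proj (𝕜 := ℝ) i : Plane →L[ℝ] ℝ).fderiv (x := x)
      simp only [partialDeriv]
      change (fderiv ℝ (⇑(EuclideanSpace.proj (𝕜 := ℝ) i : Plane →L[ℝ] ℝ)) x) _ = _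
      rw [this]; simp
    rw [this, one_mul]
  have hi : ∀ i : Fin 2, Integrable fun x : Plane => x i * partialDeriv i η x := fun i =>
    (Continuous.mul (by fun_prop) (continuous_partialDeriv hη1 i)).integrable_of_hasCompactSupport
      (HasCompactSupport.partialDeriv hs i).mul_left
  have e : ∀ x : Plane, extPotential c x 0 * partialDeriv 1 η x -
      extPotential c x 1 * partialDeriv 0 η x =
      -(c / 2) * (x 0 * partialDeriv 0 η x + x 1 * partialDeriv 1 η x) := fun x => by
    simp [extPotential]; ring
  simp only [e]
  rw [integral_const_mul, integral_const_mul, integral_add (hi 0) (hi 1), h, h]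
  ring

theorem locMemLp_of_continuous {F : Type} [NormedAddCommGroup F] {f : Plane → F}
    (hf : Continuous f) (p : ℝ≥0∞) : LocMemLp f p := by
  intro K hK
  have : IsFiniteMeasure (volume.restrict K) := isFiniteMeasure_restrict.2 hK.measure_lt_top.ne
  obtain ⟨M, hM⟩ := hK.exists_bound_of_continuousOn hf.continuousOn
  exact MemLp.of_bound hf.aestronglyMeasurable.restrict M
    ((ae_restrict_mem hK.measurableSet).mono hM)

theorem continuous_extPotential (c : ℝ) : Continuous (extPotential c) := by
  have h : Continuous fun x : Plane => (!₂[-(x 1), x 0] : Plane) := by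
    refine (PiLp.continuous_toLp 2 fun _ : Fin 2 => ℝ).comp
      (continuous_pi (A := fun _ => ℝ) fun i => ?_)
    fin_cases i
    · change Continuous fun x : Plane => -(x 1)
      fun_prop
    · change Continuous fun x : Plane => x 0
      fun_prop
  exact h.const_smul (c / 2)

theorem LocMemLp.totalPotential {a : Plane → Plane} (ha : LocMemLp a 2) (e g c s : ℝ) :
    LocMemLp (totalPotential e g c s a) 2 := by
  intro K hK
  have h1 := (locMemLp_of_continuous (continuous_extPotential c) 2 K hK).const_smul e
  have h2 := (ha K hK).const_smul (s * g)
  exact h1.add h2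

theorem LocMemLp.totalField {b : Plane → ℝ} {p : ℝ≥0∞} (hb : LocMemLp b p) (e g c s : ℝ) :
    LocMemLp (totalField e g c s b) p := by
  intro K hK
  have h1 := locMemLp_of_continuous (continuous_const (y := e * c)) p K hK
  have h2 := (hb K hK).const_mul (s * g)
  exact h1.add h2

theorem IsDistribCurl.total {a : Plane → Plane} {b : Plane → ℝ} (h : IsDistribCurl a b)
    (ha : LocMemLp a 2) (hb : LocallyIntegrable b) (e g c s : ℝ) :
    IsDistribCurl (totalPotential e g c s a) (totalField e g c s b) := by
  intro η hη hs
  have hη1 : ContDiff ℝ 1 η := hη.of_le (by simp)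
  have hA : ∀ {a : Plane → Plane}, LocMemLp a 2 →
      Integrable fun x => a x 0 * partialDeriv 1 η x - a x 1 * partialDeriv 0 η x := fun ha =>
    (integrable_mul_of_locallyIntegrable (ha.coord_locallyIntegrable 0)
      (continuous_partialDeriv hη1 1) (HasCompactSupport.partialDeriv hs 1)).sub
    (integrable_mul_of_locallyIntegrable (ha.coord_locallyIntegrable 1)
      (continuous_partialDeriv hη1 0) (HasCompactSupport.partialDeriv hs 0))
  have e1 : ∀ x, PauliDomination.totalField e g c s b x * η x =
      e * (c * η x) + (s * g) * (b x * η x) := fun x => by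
    simp only [PauliDomination.totalField]; ring
  have e2 : ∀ x, PauliDomination.totalPotential e g c s a x 0 * partialDeriv 1 η x -
      PauliDomination.totalPotential e g c s a x 1 * partialDeriv 0 η x =
      e * (extPotential c x 0 * partialDeriv 1 η x - extPotential c x 1 * partialDeriv 0 η x) +
      (s * g) * (a x 0 * partialDeriv 1 η x - a x 1 * partialDeriv 0 η x) := fun x => by
    simp [PauliDomination.totalPotential]; ring
  simp only [e1, e2]
  have hc : Integrable fun x => c * η x :=
    (hη.continuous.integrable_of_hasCompactSupport hs).const_mul c
  have hext := hA (locMemLp_of_continuous (continuous_extPotential c) 2)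
  rw [integral_add (hc.const_mul e)
      ((integrable_mul_of_locallyIntegrable hb hη.continuous hs).const_mul _),
    integral_add (hext.const_mul e) ((hA ha).const_mul _), integral_const_mul, integral_const_mul,
    integral_const_mul (s * g), integral_const_mul e, h η hη hs,
    ← isDistribCurl_extPotential c η hη hs, integral_const_mul, integral_const_mul (s * g)]

/-! ### Spinors in real coordinates -/

/-- The real part of a spinor component. -/
def spinorRe (j : Fin 2) : Spinor →L[ℝ] ℝ :=
  Complex.reCLM.comp ((EuclideanSpace.proj (𝕜 := ℂ) j).restrictScalars ℝ)

/-- The imaginary part of a spinor component. -/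
def spinorIm (j : Fin 2) : Spinor →L[ℝ] ℝ :=
  Complex.imCLM.comp ((EuclideanSpace.proj (𝕜 := ℂ) j).restrictScalars ℝ)

@[simp] theorem spinorRe_apply (j : Fin 2) (v : Spinor) : spinorRe j v = (v j).re := rfl

@[simp] theorem spinorIm_apply (j : Fin 2) (v : Spinor) : spinorIm j v = (v j).im := rfl

theorem spinor_norm_sq (v : Spinor) :
    ‖v‖ ^ 2 = (v 0).re ^ 2 + (v 0).im ^ 2 + ((v 1).re ^ 2 + (v 1).im ^ 2) := by
  rw [EuclideanSpace.norm_sq_eq, Fin.sum_univ_two, Complex.sq_norm, Complex.sq_norm,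
    Complex.normSq_apply, Complex.normSq_apply]
  ring

/-- The density `|Ψ_j|²` of a spinor component. -/
def compDensity (j : Fin 2) (Ψ : Plane → Spinor) (x : Plane) : ℝ :=
  spinorRe j (Ψ x) ^ 2 + spinorIm j (Ψ x) ^ 2

theorem compDensity_add (Ψ : Plane → Spinor) (x : Plane) :
    compDensity 0 Ψ x + compDensity 1 Ψ x = ‖Ψ x‖ ^ 2 := by
  simp [spinor_norm_sq, compDensity]

theorem contDiff_compDensity {Ψ : Plane → Spinor} {n : ℕ∞ω} (h : ContDiff ℝ n Ψ) (j : Fin 2) :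
    ContDiff ℝ n (compDensity j Ψ) :=
  (((spinorRe j).contDiff.comp h).pow 2).add (((spinorIm j).contDiff.comp h).pow 2)

theorem partialDeriv_clm {Ψ : Plane → Spinor} {x : Plane} (h : DifferentiableAt ℝ Ψ x)
    (L : Spinor →L[ℝ] ℝ) (i : Fin 2) :
    partialDeriv i (fun y => L (Ψ y)) x = L (partialDeriv i Ψ x) := by
  have := (L.hasFDerivAt.comp x h.hasFDerivAt).fderiv
  unfold partialDeriv
  change fderiv ℝ (⇑L ∘ Ψ) x _ = _
  rw [this]; rfl

theorem partialDeriv_compDensity {Ψ : Plane → Spinor} {x : Plane} (h : DifferentiableAt ℝ Ψ x)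
    (j : Fin 2) : DifferentiableAt ℝ (compDensity j Ψ) x ∧ ∀ i, partialDeriv i (compDensity j Ψ) x =
      2 * ((Ψ x j).re * (partialDeriv i Ψ x j).re + (Ψ x j).im * (partialDeriv i Ψ x j).im) := by
  have h1 := (((spinorRe j).hasFDerivAt.comp x h.hasFDerivAt).pow 2).add
    (((spinorIm j).hasFDerivAt.comp x h.hasFDerivAt).pow 2)
  have h2 : HasFDerivAt (compDensity j Ψ) _ x := h1
  refine ⟨h2.differentiableAt, fun i => ?_⟩
  unfold partialDeriv
  rw [h2.fderiv]
  simp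
  ring

/-- The diamagnetic inequality, in the form `|∂ᵢ|Ψ|²| ≤ 2 |Ψ| |(p_A)ᵢ Ψ|`. -/
theorem norm_partialDeriv_norm_sq_le {Ψ : Plane → Spinor} {x : Plane}
    (h : DifferentiableAt ℝ Ψ x) (A : Plane → Plane) (i : Fin 2) :
    ‖partialDeriv i (fun y => ‖Ψ y‖ ^ 2) x‖ ≤ 2 * (‖Ψ x‖ * ‖magMomentum A i Ψ x‖) := by
  have h0 := partialDeriv_compDensity h 0
  have h1 := partialDeriv_compDensity h 1
  have e : partialDeriv i (fun y => ‖Ψ y‖ ^ 2) x =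
      2 * (inner ℂ (Ψ x) (Complex.I • magMomentum A i Ψ x)).re := by
    have : (fun y => ‖Ψ y‖ ^ 2) = compDensity 0 Ψ + compDensity 1 Ψ := by
      ext y; exact (compDensity_add Ψ y).symm
    rw [this]
    have hadd : partialDeriv i (compDensity 0 Ψ + compDensity 1 Ψ) x =
        partialDeriv i (compDensity 0 Ψ) x + partialDeriv i (compDensity 1 Ψ) x := by
      unfold partialDeriv; rw [fderiv_add h0.1 h1.1]; rfl
    rw [hadd, h0.2, h1.2]
    have him : ((‖Ψ x‖ : ℂ) ^ 2).im = 0 := by rw [← Complex.ofReal_pow]; exact Complex.ofReal_im _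
    simp [PiLp.inner_apply, magMomentum]
    rw [him]
    ring
  rw [e, norm_mul, Real.norm_ofNat]
  gcongr
  calc _ ≤ ‖inner ℂ (Ψ x) (Complex.I • magMomentum A i Ψ x)‖ := Complex.abs_re_le_norm _
    _ ≤ ‖Ψ x‖ * ‖Complex.I • magMomentum A i Ψ x‖ := norm_inner_le_norm _ _
    _ = _ := by rw [norm_smul, Complex.norm_I, one_mul]

/-- Pointwise Lichnerowicz formula. The cross terms are written without derivatives of `A`, so that
for `A` merely in $L^2_{\rm loc}$ the first bracket can be tested against the distributional curl;
the other two are Jacobians, which integrate to zero. -/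
theorem norm_pauliDirac_sq {Ψ : Plane → Spinor} {x : Plane} (h : DifferentiableAt ℝ Ψ x)
    (A : Plane → Plane) :
    ‖pauliDirac A Ψ x‖ ^ 2 = ∑ i : Fin 2, ‖magMomentum A i Ψ x‖ ^ 2 -
      (A x 0 * partialDeriv 1 (fun y => compDensity 0 Ψ y - compDensity 1 Ψ y) x -
        A x 1 * partialDeriv 0 (fun y => compDensity 0 Ψ y - compDensity 1 Ψ y) x) -
      2 * (partialDeriv 0 (fun y => spinorRe 0 (Ψ y)) x * partialDeriv 1 (fun y => spinorIm 0 (Ψ y)) x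
        - partialDeriv 1 (fun y => spinorRe 0 (Ψ y)) x * partialDeriv 0 (fun y => spinorIm 0 (Ψ y)) x) +
      2 * (partialDeriv 0 (fun y => spinorRe 1 (Ψ y)) x * partialDeriv 1 (fun y => spinorIm 1 (Ψ y)) x
        - partialDeriv 1 (fun y => spinorRe 1 (Ψ y)) x *
          partialDeriv 0 (fun y => spinorIm 1 (Ψ y)) x) := by
  have h0 := partialDeriv_compDensity h 0
  have h1 := partialDeriv_compDensity h 1
  have hsub : ∀ i, partialDeriv i (fun y => compDensity 0 Ψ y - compDensity 1 Ψ y) x =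
      partialDeriv i (compDensity 0 Ψ) x - partialDeriv i (compDensity 1 Ψ) x := fun i => by
    unfold partialDeriv; rw [fderiv_fun_sub h0.1 h1.1]; rfl
  simp only [partialDeriv_clm h, hsub, h0.2, h1.2, spinor_norm_sq, Fin.sum_univ_two]
  simp [pauliDirac, magMomentum, pauliMatrix, Matrix.toLpLin_apply]
  ring

theorem memLp_magMomentum {A : Plane → Plane} (hA : LocMemLp A 2) {Ψ : Plane → Spinor}
    (hΨ : IsTestSpinor Ψ) (i : Fin 2) : MemLp (magMomentum A i Ψ) 2 volume := by
  have hcont := hΨ.1.continuous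
  have h1 : MemLp (partialDeriv i Ψ) 2 volume :=
    (continuous_partialDeriv (hΨ.1.of_le (by simp)) i).memLp_of_hasCompactSupport
      (HasCompactSupport.partialDeriv hΨ.2 i)
  have h2 : MemLp (fun x => ((A x i : ℝ) : ℂ) • Ψ x) 2 volume := by
    have hK : MemLp ((tsupport Ψ).indicator A) 2 volume :=
      (memLp_indicator_iff_restrict (isClosed_tsupport Ψ).measurableSet).2 (hA _ hΨ.2)
    obtain ⟨M, hM⟩ := hΨ.2.exists_bound_of_continuous hcont
    refine hK.of_le_mul (c := M) ?_ (.of_forall fun x => ?_)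
    · exact (Complex.continuous_ofReal.comp_aestronglyMeasurable
        (hA.coord_locallyIntegrable i).aestronglyMeasurable).smul hcont.aestronglyMeasurable
    · by_cases hx : x ∈ tsupport Ψ
      · rw [Set.indicator_of_mem hx, norm_smul, mul_comm, Complex.norm_real]
        have := (norm_nonneg (Ψ x)).trans (hM x)
        exact mul_le_mul (hM x) (PiLp.norm_apply_le _ i) (norm_nonneg _) this
      · rw [image_eq_zero_of_notMem_tsupport hx, Set.indicator_of_notMem hx]
        simp
  exact (h1.const_smul Complex.I).neg.sub h2

/-- Finiteness is what permits absorbing half of this form into the left-hand side at the end. -/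
theorem schrodingerForm_ne_top {A : Plane → Plane} (hA : LocMemLp A 2) {Ψ : Plane → Spinor}
    (hΨ : IsTestSpinor Ψ) : schrodingerForm A Ψ ≠ ⊤ := by
  have h : ∀ i, AEMeasurable (fun x => ‖magMomentum A i Ψ x‖ₑ ^ 2) := fun i =>
    (memLp_magMomentum hA hΨ i).1.enorm.pow_const 2
  rw [schrodingerForm, lintegral_finsetSum' _ fun i _ => h i]
  refine (ENNReal.sum_lt_top.2 fun i _ => ?_).ne
  have := (memLp_magMomentum hA hΨ i).integrable_norm_pow (p := 2) (by norm_num)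
  have := this.2
  simpa [HasFiniteIntegral] using this

theorem ofReal_integral_norm_sq {f : Plane → Spinor} (hf : Integrable fun x => ‖f x‖ ^ 2) :
    ENNReal.ofReal (∫ x, ‖f x‖ ^ 2) = ∫⁻ x, ‖f x‖ₑ ^ 2 := by
  rw [ofReal_integral_eq_lintegral_ofReal hf (.of_forall fun x => by positivity)]
  simp only [ENNReal.ofReal_pow (norm_nonneg _), ofReal_norm]

/-- The Lichnerowicz formula `P_A² = p_A² - σ₃ B`, as an inequality of forms. -/
theorem schrodingerForm_le {A : Plane → Plane} {B : Plane → ℝ} (hA : LocMemLp A 2)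
    (hB : LocallyIntegrable B) (h : IsDistribCurl A B) {Ψ : Plane → Spinor}
    (hΨ : IsTestSpinor Ψ) :
    schrodingerForm A Ψ ≤ pauliForm A Ψ + ∫⁻ x, ‖B x‖ₑ * ‖Ψ x‖ₑ ^ 2 := by
  have hΨ1 : ContDiff ℝ 1 Ψ := hΨ.1.of_le (by simp)
  have hcs : ∀ L : Spinor →L[ℝ] ℝ, HasCompactSupport fun x => L (Ψ x) := fun L =>
    hΨ.2.comp_left (g := L) (map_zero L)
  have hcd : ∀ L : Spinor →L[ℝ] ℝ, ContDiff ℝ ∞ fun x => L (Ψ x) := fun L => L.contDiff.comp hΨ.1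
  -- The density $\langle\Psi,\sigma_3\Psi\rangle$ is smooth with compact support, hence a
  -- legitimate test function for the curl, and $|\eta|\le|\Psi|^2$.
  set η : Plane → ℝ := fun y => compDensity 0 Ψ y - compDensity 1 Ψ y with hη
  have hηd : ContDiff ℝ ∞ η := (contDiff_compDensity hΨ.1 0).sub (contDiff_compDensity hΨ.1 1)
  have hηs : HasCompactSupport η :=
    hΨ.2.comp_left (g := fun v : Spinor => (spinorRe 0 v ^ 2 + spinorIm 0 v ^ 2) -
      (spinorRe 1 v ^ 2 + spinorIm 1 v ^ 2)) (by simp)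
  have hp : ∀ i, Integrable fun x => ‖magMomentum A i Ψ x‖ ^ 2 := fun i =>
    (memLp_magMomentum hA hΨ i).integrable_norm_pow (p := 2) (by norm_num)
  have hsum : Integrable fun x => ∑ i : Fin 2, ‖magMomentum A i Ψ x‖ ^ 2 :=
    integrable_finsetSum _ fun i _ => hp i
  have hcurl : Integrable fun x => A x 0 * partialDeriv 1 η x - A x 1 * partialDeriv 0 η x :=
    (integrable_mul_of_locallyIntegrable (hA.coord_locallyIntegrable 0)
      (contDiff_partialDeriv hηd 1).continuous (HasCompactSupport.partialDeriv hηs 1)).sub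
    (integrable_mul_of_locallyIntegrable (hA.coord_locallyIntegrable 1)
      (contDiff_partialDeriv hηd 0).continuous (HasCompactSupport.partialDeriv hηs 0))
  have hj : ∀ j : Fin 2, Integrable fun x =>
      partialDeriv 0 (fun y => spinorRe j (Ψ y)) x * partialDeriv 1 (fun y => spinorIm j (Ψ y)) x -
      partialDeriv 1 (fun y => spinorRe j (Ψ y)) x * partialDeriv 0 (fun y => spinorIm j (Ψ y)) x :=
    fun j => by
      have hi : ∀ k l : Fin 2, Integrable fun x => partialDeriv k (fun y => spinorRe j (Ψ y)) x *
          partialDeriv l (fun y => spinorIm j (Ψ y)) x := fun k l =>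
        ((contDiff_partialDeriv (hcd (spinorRe j)) k).continuous.mul
          (contDiff_partialDeriv (hcd (spinorIm j)) l).continuous).integrable_of_hasCompactSupport
          (HasCompactSupport.partialDeriv (hcs (spinorRe j)) k).mul_right
      exact (hi 0 1).sub (hi 1 0)
  let F : Plane → ℝ := fun x => ∑ i : Fin 2, ‖magMomentum A i Ψ x‖ ^ 2
  let K : Plane → ℝ := fun x => A x 0 * partialDeriv 1 η x - A x 1 * partialDeriv 0 η x
  let J : Fin 2 → Plane → ℝ := fun j x =>
    partialDeriv 0 (fun y => spinorRe j (Ψ y)) x * partialDeriv 1 (fun y => spinorIm j (Ψ y)) x -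
    partialDeriv 1 (fun y => spinorRe j (Ψ y)) x * partialDeriv 0 (fun y => spinorIm j (Ψ y)) x
  have hpt : (fun x => ‖pauliDirac A Ψ x‖ ^ 2) = fun x => F x - K x - 2 * J 0 x + 2 * J 1 x :=
    funext fun x => norm_pauliDirac_sq (hΨ1.differentiable one_ne_zero x) A
  have hJ : ∀ j, Integrable fun x => 2 * J j x := fun j => (hj j).const_mul 2
  have hFK : Integrable fun x => F x - K x := hsum.sub hcurl
  have hFKJ : Integrable fun x => F x - K x - 2 * J 0 x := hFK.sub (hJ 0)
  have hP : Integrable fun x => ‖pauliDirac A Ψ x‖ ^ 2 := by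
    rw [hpt]; exact hFKJ.add (hJ 1)
  have hB2 : Integrable fun x => |B x| * ‖Ψ x‖ ^ 2 :=
    integrable_mul_of_locallyIntegrable (b := fun x => |B x|) (fun x => (hB x).norm) (hΨ1.continuous.norm.pow 2)
      (hΨ.2.comp_left (g := fun v : Spinor => ‖v‖ ^ 2) (by simp))
  have hJ0 : ∀ j, ∫ x, J j x = 0 := fun j =>
    integral_jacobian_eq_zero (hcd (spinorRe j)) (hcd (spinorIm j)) (hcs (spinorRe j))
  have hid : ∫ x, ‖pauliDirac A Ψ x‖ ^ 2 = (∫ x, F x) - ∫ x, B x * η x := by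
    rw [hpt, integral_add hFKJ (hJ 1), integral_sub hFK (hJ 0), integral_sub hsum hcurl,
      integral_const_mul, integral_const_mul, hJ0, hJ0, h η hηd hηs]
    ring
  have hle : ∫ x, B x * η x ≤ ∫ x, |B x| * ‖Ψ x‖ ^ 2 := by
    refine integral_mono (integrable_mul_of_locallyIntegrable hB hηd.continuous hηs) hB2 fun x => ?_
    have h0 : 0 ≤ compDensity 0 Ψ x := by unfold compDensity; positivity
    have h1 : 0 ≤ compDensity 1 Ψ x := by unfold compDensity; positivity
    have : |η x| ≤ ‖Ψ x‖ ^ 2 := by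
      rw [← compDensity_add, hη, abs_le]; constructor <;> simp only <;> linarith
    calc B x * η x ≤ |B x * η x| := le_abs_self _
      _ = |B x| * |η x| := abs_mul _ _
      _ ≤ |B x| * ‖Ψ x‖ ^ 2 := by gcongr
  have hF0 : ∀ x, 0 ≤ F x := fun x => Finset.sum_nonneg fun i _ => by positivity
  have e1 : schrodingerForm A Ψ =
      ENNReal.ofReal (∫ x, F x) := by
    rw [ofReal_integral_eq_lintegral_ofReal hsum (.of_forall hF0)]
    refine lintegral_congr fun x => ?_
    rw [ENNReal.ofReal_sum_of_nonneg fun i _ => by positivity]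
    simp only [ENNReal.ofReal_pow (norm_nonneg _), ofReal_norm]
  have e2 : ∫⁻ x, ‖B x‖ₑ * ‖Ψ x‖ₑ ^ 2 = ENNReal.ofReal (∫ x, |B x| * ‖Ψ x‖ ^ 2) := by
    rw [ofReal_integral_eq_lintegral_ofReal hB2 (.of_forall fun x => by positivity)]
    refine lintegral_congr fun x => ?_
    rw [ENNReal.ofReal_mul (abs_nonneg _), ENNReal.ofReal_pow (norm_nonneg _), ofReal_norm,
      Real.enorm_eq_ofReal_abs]
  rw [e1, e2, pauliForm, ← ofReal_integral_norm_sq hP,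
    ← ENNReal.ofReal_add (integral_nonneg fun x => by positivity)
      (integral_nonneg fun x => by positivity)]
  exact ENNReal.ofReal_le_ofReal (by linarith)

/-! ### Admissible and maximal squares -/

open DyadicSquare

variable {B : Plane → ℝ} {p ε : ℝ}

theorem exponent_pos (hp : 4 / 3 < p) : 0 < (3 * p - 4) / (2 * p) :=
  div_pos (by linarith) (by linarith)

/-- Since $p>4/3$ the exponent of $\ell$ is positive, so the threshold blows up as $\ell\to0$ while
the norm of `B` near `x` stays bounded. For $\ell\le1$ the dilate lies in the ball of radius 24. -/
theorem exists_small_admissible (hp : 4 / 3 < p) (hε : 0 < ε)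
    (hB : LocMemLp B (ENNReal.ofReal p)) (x : Plane) :
    ∃ δ : ℝ, 0 < δ ∧ ∀ S : DyadicSquare, S.side ≤ δ → x ∈ S.dilate 12 → S ∈ admissible B p ε := by
  have hγ := exponent_pos hp
  set γ := (3 * p - 4) / (2 * p) with hγdef
  have hM := (hB _ (isCompact_closedBall x 24)).2
  set M := (eLpNorm B (ENNReal.ofReal p) (volume.restrict (Metric.closedBall x 24))).toReal with hMd
  have hM0 : 0 ≤ M := ENNReal.toReal_nonneg
  refine ⟨min 1 ((ε / (M + 1)) ^ (1 / γ)), by positivity, fun S hS hx => ?_⟩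
  have hl := S.side_pos
  have hsub : S.dilate 12 ⊆ Metric.closedBall x 24 :=
    (dilate_subset_closedBall hx).trans (Metric.closedBall_subset_closedBall
      (by linarith [hS.trans (min_le_left _ _)]))
  refine (eLpNorm_mono_measure B (Measure.restrict_mono hsub le_rfl)).trans ?_
  rw [← ENNReal.ofReal_toReal hM.ne, ← hMd]
  refine ENNReal.ofReal_le_ofReal ?_
  have h1 : S.side ^ γ ≤ ε / (M + 1) := by
    calc S.side ^ γ ≤ ((ε / (M + 1)) ^ (1 / γ)) ^ γ :=
          Real.rpow_le_rpow hl.le (hS.trans (min_le_right _ _)) hγ.le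
      _ = ε / (M + 1) := by
          rw [← Real.rpow_mul (by positivity), one_div_mul_cancel hγ.ne', Real.rpow_one]
  rw [le_div_iff₀ (by positivity)]
  rw [le_div_iff₀ (by positivity)] at h1
  have : 0 < S.side ^ γ := by positivity
  nlinarith

theorem not_admissible_containing {S : DyadicSquare} (hS : S ∈ maximalSquares B p ε) {x : Plane}
    (hx : x ∈ S.halfOpen) {k : ℤ} (hk : S.scale < k) : containing k x ∉ admissible B p ε :=
  fun h => hS.2 _ h <| by
    rw [mem_halfOpen.1 hx]
    exact containing_ssubset hk x

theorem side_containing_succ (S : DyadicSquare) (x : Plane) :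
    (containing (S.scale + 1) x).side = 2 * S.side := by
  simp [side, containing, zpow_add₀, mul_comm]

theorem corner_mem_halfOpen (S : DyadicSquare) :
    (WithLp.toLp 2 fun i => S.side * S.pos i : Plane) ∈ S.halfOpen := fun i =>
  ⟨le_rfl, by have := S.side_pos; simp only; nlinarith⟩

/-- A very small square near `x` has an admissible parent and cannot be maximal. The lower bound
serves to make the series defining $\varPhi(x)$ summable. -/
theorem exists_le_side_maximal (hp : 4 / 3 < p) (hε : 0 < ε)
    (hB : LocMemLp B (ENNReal.ofReal p)) (x : Plane) :
    ∃ δ : ℝ, 0 < δ ∧ ∀ S ∈ maximalSquares B p ε, x ∈ S.dilate 2 → δ ≤ S.side := by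
  obtain ⟨δ, hδ, h⟩ := exists_small_admissible hp hε hB x
  refine ⟨δ / 2, by positivity, fun S hS hx => ?_⟩
  by_contra! hlt
  set z : Plane := WithLp.toLp 2 fun i => S.side * S.pos i
  have hz : z ∈ S.halfOpen := corner_mem_halfOpen S
  refine not_admissible_containing hS hz (lt_add_one _) (h _ ?_ ?_)
  · rw [side_containing_succ]; linarith
  · intro i
    have h1 := halfOpen_subset_toSet _ (mem_halfOpen_containing (S.scale + 1) z) i
    have h2 := halfOpen_subset_toSet _ hz i
    have h3 := hx i
    have := S.side_pos
    rw [side_containing_succ] at h1 ⊢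
    rw [abs_le] at *
    constructor <;> linarith

/-- The scales of admissible squares around `x` are bounded above by `L` and include all
sufficiently small ones; the greatest gives the maximal square. -/
theorem exists_maximal_mem (hp : 4 / 3 < p) (hε : 0 < ε)
    (hB : LocMemLp B (ENNReal.ofReal p)) {L : ℝ} (hL : ∀ S ∈ admissible B p ε, S.side ≤ L)
    (x : Plane) : ∃ S ∈ maximalSquares B p ε, x ∈ S.halfOpen := by
  obtain ⟨δ, hδ, h⟩ := exists_small_admissible hp hε hB x
  obtain ⟨n, hn⟩ := exists_pow_lt_of_lt_one hδ (by norm_num : (1 / 2 : ℝ) < 1)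
  obtain ⟨m, hm⟩ := pow_unbounded_of_one_lt L (by norm_num : (1 : ℝ) < 2)
  obtain ⟨k, hk, hmax⟩ := Int.exists_greatest_of_bdd
    (P := fun k => containing k x ∈ admissible B p ε) ⟨m, fun k hk => by
      by_contra! hlt
      have h1 : (2 : ℝ) ^ (m : ℤ) ≤ 2 ^ k := zpow_le_zpow_right₀ (by norm_num) hlt.le
      rw [zpow_natCast] at h1
      exact absurd (hL _ hk) (hm.trans_le h1).not_ge⟩
    ⟨-n, h _ (by simpa [side, containing] using hn.le)
      (dilate_mono _ (by norm_num) (halfOpen_subset_toSet _ (mem_halfOpen_containing _ x)))⟩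
  refine ⟨containing k x, ⟨hk, fun T hT hss => ?_⟩, mem_halfOpen_containing k x⟩
  have hxT := mem_halfOpen.1 (halfOpen_subset_of_subset hss.1 (mem_halfOpen_containing k x))
  have hle : k ≤ T.scale := side_le_side.1 (side_le_of_subset hss.1)
  have hge : T.scale ≤ k := hmax _ (by rwa [hxT] at hT)
  rw [hxT, le_antisymm hge hle] at hss
  exact hss.2 subset_rfl

theorem maximal_eq_of_mem {S T : DyadicSquare} (hS : S ∈ maximalSquares B p ε)
    (hT : T ∈ maximalSquares B p ε) {x : Plane} (hxS : x ∈ S.halfOpen) (hxT : x ∈ T.halfOpen) :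
    S = T := by
  rcases lt_trichotomy S.scale T.scale with h | h | h
  · exact absurd (mem_halfOpen.1 hxT ▸ hT.1) (not_admissible_containing hS hxS h)
  · rw [mem_halfOpen.1 hxS, mem_halfOpen.1 hxT, h]
  · exact absurd (mem_halfOpen.1 hxS ▸ hS.1) (not_admissible_containing hT hxT h)

/-- Otherwise $12T$ contains the twelvefold dilate of the parent of `S`. The threshold decreases
with the side, so the parent inherits admissibility from `T`, against the maximality of `S`. -/
theorem side_lt_of_mem (hp : 4 / 3 < p) (hε : 0 < ε) {S T : DyadicSquare}
    (hS : S ∈ maximalSquares B p ε) (hT : T ∈ admissible B p ε) {x : Plane} (hxS : x ∈ S.halfOpen)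
    (hxT : x ∈ T.dilate 2) : T.side < 4 * S.side := by
  by_contra! hle
  refine not_admissible_containing hS hxS (lt_add_one _) ?_
  refine (eLpNorm_mono_measure B
    (Measure.restrict_mono (dilate_parent_subset hxT hle) le_rfl)).trans (hT.trans ?_)
  have hl := S.side_pos
  rw [side_containing_succ]
  refine ENNReal.ofReal_le_ofReal (div_le_div_of_nonneg_left hε.le (by positivity) ?_)
  exact Real.rpow_le_rpow (by positivity) (by linarith) (exponent_pos hp).le

/-- Every square contributing at `x` has side below $4\ell(S)$ and the $\varphi_T^2$ sum to 1, so
$\varPhi\ge(4\ell(S))^{-3/2}$, where $4^{3/2}=8$. -/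
theorem le_locPotential (hp : 4 / 3 < p) (hε : 0 < ε) (hB : LocMemLp B (ENNReal.ofReal p))
    {φ : maximalSquares B p ε → Plane → ℝ} (hφ : IsSquarePartition (maximalSquares B p ε) φ)
    {S : DyadicSquare} (hS : S ∈ maximalSquares B p ε) {x : Plane} (hx : x ∈ S.halfOpen) :
    1 / S.side ^ (3 / 2 : ℝ) ≤ 8 * locPotential (maximalSquares B p ε) φ x := by
  have hl := S.side_pos
  obtain ⟨δ, hδ, hδS⟩ := exists_le_side_maximal hp hε hB x
  have hsum := hφ.sum_sq x
  have hmem : ∀ T : maximalSquares B p ε, φ T x ≠ 0 → x ∈ T.1.dilate 2 := fun T hT =>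
    hφ.support T (subset_tsupport _ hT)
  -- Without summability `tsum` would take the default value 0 and the lower bound would fail.
  have hsummable : Summable fun T : maximalSquares B p ε =>
      1 / T.1.side ^ (3 / 2 : ℝ) * φ T x ^ 2 := by
    refine Summable.of_nonneg_of_le (fun T => ?_) (fun T => ?_)
      (hsum.summable.mul_left (1 / δ ^ (3 / 2 : ℝ)))
    · have := T.1.side_pos
      positivity
    · by_cases h0 : φ T x = 0
      · simp [h0]
      · have := hδS _ T.2 (hmem T h0)
        gcongr
  have h4 : ∀ r : ℝ, 0 < r → 1 / (4 * r) ^ (3 / 2 : ℝ) = 1 / 8 * (1 / r ^ (3 / 2 : ℝ)) :=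
    fun r hr => by
      have : (4 : ℝ) ^ (3 / 2 : ℝ) = 8 := by
        rw [show (4 : ℝ) = 2 ^ (2 : ℝ) by norm_num, ← Real.rpow_mul (by norm_num)]
        norm_num
      rw [Real.mul_rpow (by norm_num) hr.le, this]
      field_simp
  have hle : 1 / (4 * S.side) ^ (3 / 2 : ℝ) * 1 ≤ locPotential (maximalSquares B p ε) φ x := by
    refine hasSum_le (fun T => ?_) (hsum.mul_left _) hsummable.hasSum
    by_cases h0 : φ T x = 0
    · simp [h0]
    · have h1 := (side_lt_of_mem hp hε hS T.2.1 hx (hmem T h0)).le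
      have := T.1.side_pos
      gcongr
  rw [h4 _ hl] at hle
  linarith

/-- Hölder on a set of area $\ell^2$ costs $(\ell^2)^{3/4-1/p}=\ell^{(3p-4)/(2p)}$, which cancels
the denominator of the threshold exactly. -/
theorem eLpNorm_four_thirds_le (hp : 4 / 3 < p) (hε : 0 < ε) (hB : AEStronglyMeasurable B volume)
    {S : DyadicSquare} (hS : S ∈ admissible B p ε) :
    eLpNorm B (ENNReal.ofReal (4 / 3)) (volume.restrict S.halfOpen) ≤ ENNReal.ofReal ε := by
  have hl := S.side_pos
  have hsub : S.halfOpen ⊆ S.dilate 12 :=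
    S.halfOpen_subset_toSet.trans (S.dilate_mono (by norm_num))
  have h := eLpNorm_le_eLpNorm_mul_rpow_measure_univ (μ := volume.restrict S.halfOpen)
    (ENNReal.ofReal_le_ofReal hp.le) hB.restrict
  rw [Measure.restrict_apply_univ, S.volume_halfOpen, ENNReal.toReal_ofReal (by norm_num),
    ENNReal.toReal_ofReal (by linarith), ENNReal.ofReal_rpow_of_pos (by positivity)] at h
  refine h.trans ((mul_le_mul_left ((eLpNorm_mono_measure B
    (Measure.restrict_mono hsub le_rfl)).trans hS) _).trans (le_of_eq ?_))
  rw [← ENNReal.ofReal_mul (by positivity)]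
  congr 1
  have : (S.side ^ 2) ^ (1 / (4 / 3) - 1 / p) = S.side ^ ((3 * p - 4) / (2 * p)) := by
    rw [← Real.rpow_natCast, ← Real.rpow_mul hl.le]
    congr 1
    have : p ≠ 0 := by linarith
    field_simp
    push_cast
    ring
  rw [this]
  field_simp

/-- For $\ell>1$ and $\varepsilon\le1$ the threshold is at most 1, while $|B|+|h|\ge c$ gives
$c\,\ell^{2/p}\le1+\|h\|_p$. The bound is uniform in $\varepsilon\le1$, so `L` can be fixed before
$\varepsilon_0$. -/
theorem exists_side_bound (hp : 4 / 3 < p) (hB : AEStronglyMeasurable B volume) {h : Plane → ℝ}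
    (hh : MemLp h (ENNReal.ofReal p) volume) {c : ℝ} (hc : 0 < c)
    (hae : ∀ᵐ x, c ≤ |B x| + |h x|) :
    ∃ L : ℝ, 1 ≤ L ∧ ∀ ε ≤ 1, ∀ S ∈ admissible B p ε, S.side ≤ L := by
  have hp0 : 0 < p := by linarith
  have hp1 : 1 ≤ ENNReal.ofReal p := by
    rw [← ENNReal.ofReal_one]; exact ENNReal.ofReal_le_ofReal (by linarith)
  set N := (eLpNorm h (ENNReal.ofReal p) volume).toReal with hN
  have hN0 : 0 ≤ N := ENNReal.toReal_nonneg
  refine ⟨max 1 (((1 + N) / c) ^ (p / 2)), le_max_left _ _, fun ε hε S hS => ?_⟩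
  by_cases h1 : S.side ≤ 1
  · exact h1.trans (le_max_left _ _)
  push Not at h1
  refine le_trans ?_ (le_max_right _ _)
  have hl := S.side_pos
  set μ := volume.restrict (S.dilate 12) with hμ
  have hvol : ENNReal.ofReal (S.side ^ 2) ≤ μ Set.univ := by
    rw [Measure.restrict_apply_univ, ← S.volume_halfOpen]
    exact measure_mono (S.halfOpen_subset_toSet.trans (S.dilate_mono (by norm_num)))
  have hμ0 : μ ≠ 0 := fun h0 => by
    rw [h0] at hvol
    simp only [Measure.coe_zero, Pi.zero_apply, nonpos_iff_eq_zero, ENNReal.ofReal_eq_zero] at hvol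
    nlinarith
  have e1 : eLpNorm (fun _ : Plane => c) (ENNReal.ofReal p) μ ≤
      ENNReal.ofReal 1 + ENNReal.ofReal N := by
    calc _ ≤ eLpNorm ((fun x => |B x|) + fun x => |h x|) (ENNReal.ofReal p) μ := by
          refine eLpNorm_mono_ae ((ae_restrict_of_ae hae).mono fun x hx => ?_)
          rw [Real.norm_eq_abs, abs_of_pos hc]
          exact hx.trans (le_abs_self _)
      _ ≤ eLpNorm (fun x => |B x|) (ENNReal.ofReal p) μ +
            eLpNorm (fun x => |h x|) (ENNReal.ofReal p) μ :=
          eLpNorm_add_le hB.restrict.norm hh.1.restrict.norm hp1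
      _ = eLpNorm B (ENNReal.ofReal p) μ + eLpNorm h (ENNReal.ofReal p) μ := by
          congr 1
          · exact eLpNorm_norm B
          · exact eLpNorm_norm h
      _ ≤ _ := by
          refine add_le_add (hS.trans (ENNReal.ofReal_le_ofReal ?_)) ?_
          · rw [div_le_one (by positivity)]
            exact hε.trans (Real.one_le_rpow h1.le (exponent_pos hp).le)
          · rw [hN, ENNReal.ofReal_toReal hh.2.ne]
            exact eLpNorm_mono_measure h Measure.restrict_le_self
  have e2 : ENNReal.ofReal (c * (S.side ^ 2) ^ (1 / p)) ≤
      eLpNorm (fun _ : Plane => c) (ENNReal.ofReal p) μ := by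
    rw [eLpNorm_const _ (by simpa using hp0) hμ0, ENNReal.ofReal_mul hc.le,
      ENNReal.toReal_ofReal hp0.le, Real.enorm_eq_ofReal hc.le,
      ← ENNReal.ofReal_rpow_of_pos (by positivity)]
    gcongr
  have e3 := e2.trans e1
  rw [← ENNReal.ofReal_add (by norm_num) hN0, ENNReal.ofReal_le_ofReal_iff (by positivity)] at e3
  have e4 : (S.side ^ 2) ^ (1 / p) ≤ (1 + N) / c := by rw [le_div_iff₀ hc]; linarith
  calc S.side = ((S.side ^ 2) ^ (1 / p)) ^ (p / 2) := by
        rw [← Real.rpow_natCast, ← Real.rpow_mul hl.le, ← Real.rpow_mul hl.le]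
        have : ((2 : ℕ) : ℝ) * (1 / p) * (p / 2) = 1 := by push_cast; field_simp
        rw [this, Real.rpow_one]
    _ ≤ _ := Real.rpow_le_rpow (by positivity) e4 (by positivity)

theorem exists_side_bound_totalField (hp : 4 / 3 < p) {e g c s : ℝ} {b : Plane → ℝ} (he : e ≠ 0)
    (hc : 0 < c) (hloc : LocMemLp b (ENNReal.ofReal p))
    (hbm : AEStronglyMeasurable b volume)
    (hb : MemLp b (ENNReal.ofReal p) volume ∨ VanishesAtInfinity b) :
    ∃ L : ℝ, 1 ≤ L ∧ ∀ ε ≤ 1, ∀ S ∈ admissible (totalField e g c s b) p ε, S.side ≤ L := by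
  have hec : 0 < |e * c| := abs_pos.2 (mul_ne_zero he hc.ne')
  have hBm : AEStronglyMeasurable (totalField e g c s b) volume :=
    aestronglyMeasurable_const.add (hbm.const_mul (s * g))
  have htri : ∀ x, |e * c| ≤ |totalField e g c s b x| + |s * g * b x| := fun x => by
    have := abs_sub (totalField e g c s b x) (s * g * b x)
    simpa [totalField] using this
  rcases hb with hb | hb
  · exact exists_side_bound hp hBm (hb.const_mul (s * g)) hec (.of_forall htri)
  -- Chosen so that $|b|\le t$ outside a ball forces $|sgb|\le|ec|/2$ there; only the part of `b` in
  -- the ball is kept as `h`. The $+1$ covers $g=0$.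
  · set t := |e * c| / (2 * (|s * g| + 1)) with ht
    have ht0 : 0 < t := by positivity
    obtain ⟨κ, hκ⟩ := (hb.eventually_lt_const (ENNReal.ofReal_pos.2 ht0)).exists
    have hind : MemLp ((Metric.ball (0 : Plane) κ).indicator b) (ENNReal.ofReal p) volume :=
      (memLp_indicator_iff_restrict measurableSet_ball).2 ((hloc _ (isCompact_closedBall 0 κ)).mono_measure
        (Measure.restrict_mono Metric.ball_subset_closedBall le_rfl))
    refine exists_side_bound hp hBm (hind.const_mul (s * g)) (half_pos hec) ?_
    rw [eLpNorm_exponent_top] at hκ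
    filter_upwards [enorm_ae_le_eLpNormEssSup ({x : Plane | κ ≤ ‖x‖}.indicator b) volume] with x hx
    by_cases hxκ : κ ≤ ‖x‖
    · rw [Set.indicator_of_mem (show x ∈ {x : Plane | κ ≤ ‖x‖} from hxκ)] at hx
      have h1 := (hx.trans_lt hκ).le
      rw [Real.enorm_eq_ofReal_abs, ENNReal.ofReal_le_ofReal_iff ht0.le, ht,
        le_div_iff₀ (by positivity)] at h1
      have h2 := htri x
      have h3 : |s * g * b x| ≤ |e * c| / 2 := by
        rw [abs_mul]; nlinarith [abs_nonneg (b x)]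
      have := abs_nonneg (s * g * (Metric.ball (0 : Plane) κ).indicator b x)
      linarith
    · rw [Set.indicator_of_mem (show x ∈ Metric.ball (0 : Plane) κ by simpa using hxκ)]
      linarith [htri x]

/-! ### Passage to closed forms and summation over the squares -/

/-- The two relaxations range over the same approximating sequences, so an inequality on test
spinors passes to the lower limits and then to the infimum. -/
theorem FormLE.of_test {q₁ q₂ : (Plane → Spinor) → ℝ≥0∞} {C : ℝ} (hC : 0 < C)
    (h : ∀ Ψ, IsTestSpinor Ψ → q₁ Ψ ≤ ENNReal.ofReal C * q₂ Ψ) : FormLE q₁ C q₂ := by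
  refine ⟨h, fun Ψ _ => ?_⟩
  refine ENNReal.le_mul_of_forall_lt (.inl (ENNReal.ofReal_pos.2 hC).ne')
    (.inl ENNReal.ofReal_ne_top) fun c hc d hd => ?_
  simp only [formClosure, iInf_lt_iff] at hd
  obtain ⟨u, hu, hlim, hlt⟩ := hd
  calc formClosure q₁ Ψ ≤ liminf (fun n => q₁ (u n)) atTop :=
        iInf_le_of_le u (iInf_le_of_le hu (iInf_le_of_le hlim le_rfl))
    _ ≤ liminf (fun n => ENNReal.ofReal C * q₂ (u n)) atTop :=
        liminf_le_liminf (.of_forall fun n => h _ (hu n))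
    _ = ENNReal.ofReal C * liminf (fun n => q₂ (u n)) atTop :=
        ENNReal.liminf_const_mul_of_ne_top ENNReal.ofReal_ne_top
    _ ≤ c * d := by gcongr

/-- The plane is tiled by the half-open maximal squares. -/
theorem lintegral_eq_tsum_maximal {B : Plane → ℝ} {p ε : ℝ} (hp : 4 / 3 < p) (hε : 0 < ε)
    (hB : LocMemLp B (ENNReal.ofReal p)) {L : ℝ} (hL : ∀ S ∈ admissible B p ε, S.side ≤ L)
    (f : Plane → ℝ≥0∞) :
    ∫⁻ x, f x = ∑' S : maximalSquares B p ε, ∫⁻ x in S.1.halfOpen, f x := by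
  have hU : (⋃ S : maximalSquares B p ε, S.1.halfOpen) = Set.univ :=
    Set.eq_univ_of_forall fun x => by
      obtain ⟨S, hS, hx⟩ := exists_maximal_mem hp hε hB hL x
      exact Set.mem_iUnion.2 ⟨⟨S, hS⟩, hx⟩
  rw [← lintegral_iUnion (s := fun S : maximalSquares B p ε => S.1.halfOpen)
    (fun S => measurableSet_halfOpen S.1) _ f, hU, setLIntegral_univ]
  intro S T hST
  refine Set.disjoint_left.2 fun x hxS hxT => hST (Subtype.ext ?_)
  exact maximal_eq_of_mem S.2 T.2 hxS hxT

theorem lintegral_field_mul_le {A : Plane → Plane} {B : Plane → ℝ} {p ε : ℝ} (hp : 4 / 3 < p)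
    (hε : 0 < ε) (hA : LocMemLp A 2) (hB : LocMemLp B (ENNReal.ofReal p))
    (hBm : AEStronglyMeasurable B volume) {L : ℝ} (hL1 : 1 ≤ L)
    (hL : ∀ S ∈ admissible B p ε, S.side ≤ L) (hεL : 14 * ε * L ≤ 1)
    {φ : maximalSquares B p ε → Plane → ℝ} (hφ : IsSquarePartition (maximalSquares B p ε) φ)
    {Ψ : Plane → Spinor} (hΨ : IsTestSpinor Ψ) :
    ∫⁻ x, ‖B x‖ₑ * ‖Ψ x‖ₑ ^ 2 ≤ ENNReal.ofReal (1 / 2) * schrodingerForm A Ψ +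
      4 * potentialForm (locPotential (maximalSquares B p ε) φ) Ψ := by
  have hΨ1 : ContDiff ℝ 1 Ψ := hΨ.1.of_le (by simp)
  set W := locPotential (maximalSquares B p ε) φ with hW
  have hw : ContDiff ℝ 1 fun x => ‖Ψ x‖ ^ 2 := by
    have : (fun y => ‖Ψ y‖ ^ 2) = compDensity 0 Ψ + compDensity 1 Ψ := by
      ext y; exact (compDensity_add Ψ y).symm
    rw [this]
    exact (contDiff_compDensity hΨ1 0).add (contDiff_compDensity hΨ1 1)
  have hwU : ∀ x, ‖‖Ψ x‖ ^ 2‖ₑ = ‖Ψ x‖ₑ ^ 2 := fun x => by rw [enorm_pow, enorm_norm]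
  have hmom : ∀ i, AEMeasurable fun x => ‖magMomentum A i Ψ x‖ₑ := fun i =>
    (memLp_magMomentum hA hΨ i).1.enorm
  have hGw : ∀ i x, ‖partialDeriv i (fun x => ‖Ψ x‖ ^ 2) x‖ₑ ≤
      2 * (‖Ψ x‖ₑ * ‖magMomentum A i Ψ x‖ₑ) := fun i x => by
    have h := ENNReal.ofReal_le_ofReal
      (norm_partialDeriv_norm_sq_le (hΨ1.differentiable one_ne_zero x) A i)
    rwa [ofReal_norm, ENNReal.ofReal_mul (by norm_num), ENNReal.ofReal_mul (norm_nonneg _),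
      ofReal_norm, ofReal_norm, ENNReal.ofReal_ofNat] at h
  have hloc : ∀ S ∈ maximalSquares B p ε, ∫⁻ x in S.halfOpen, ‖B x‖ₑ * ‖Ψ x‖ₑ ^ 2 ≤
      ENNReal.ofReal (1 / 2) * (∫⁻ x in S.halfOpen, ∑ i : Fin 2, ‖magMomentum A i Ψ x‖ₑ ^ 2) +
      4 * ∫⁻ x in S.halfOpen, ENNReal.ofReal (W x) * ‖Ψ x‖ₑ ^ 2 := by
    intro S hS
    have hl := S.side_pos
    have hlL := hL S hS.1
    have hfin : ∫⁻ x in S.halfOpen, ∑ i : Fin 2, ‖magMomentum A i Ψ x‖ₑ ^ 2 ≠ ⊤ :=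
      ((setLIntegral_le_lintegral _ _).trans_lt (schrodingerForm_ne_top hA hΨ).lt_top).ne
    have hmain := lintegral_halfOpen_mul_sq_le hw S hΨ1.continuous.enorm.measurable hwU hmom hGw
      hfin hBm
    refine hmain.trans ((mul_le_mul_left (eLpNorm_four_thirds_le hp hε hBm hS.1) _).trans ?_)
    rw [← mul_assoc, mul_add, ← mul_assoc, ← mul_assoc]
    have h7 : ENNReal.ofReal ε * 7 = ENNReal.ofReal (ε * 7) := by
      rw [ENNReal.ofReal_mul hε.le, ENNReal.ofReal_ofNat]
    -- As $L\ge1$, its square root is at most $L$; together with $14\varepsilon L\le1$ this makes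
    -- the energy coefficient $7\varepsilon\ell^{1/2}$ at most $\frac12$.
    have hroot : S.side ^ (1 / 2 : ℝ) ≤ L := by
      calc S.side ^ (1 / 2 : ℝ) ≤ L ^ (1 / 2 : ℝ) := Real.rpow_le_rpow hl.le hlL (by norm_num)
        _ ≤ L ^ (1 : ℝ) := Real.rpow_le_rpow_of_exponent_le hL1 (by norm_num)
        _ = L := Real.rpow_one L
    have h32 : S.side ^ (1 / 2 : ℝ) * S.side⁻¹ ^ 2 = 1 / S.side ^ (3 / 2 : ℝ) := by
      rw [one_div (S.side ^ _), ← Real.rpow_neg hl.le, inv_pow, ← Real.rpow_natCast, ← Real.rpow_neg hl.le,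
        ← Real.rpow_add hl]
      norm_num
    rw [h7, h32, ← ENNReal.ofReal_mul (by positivity)]
    refine add_le_add ?_ ?_
    · gcongr
      nlinarith
    · rw [mul_assoc, ← lintegral_const_mul' _ _ ENNReal.ofReal_ne_top]
      have hint : ∫⁻ x in S.halfOpen, ENNReal.ofReal (1 / S.side ^ (3 / 2 : ℝ)) * ‖Ψ x‖ₑ ^ 2 ≤
          8 * ∫⁻ x in S.halfOpen, ENNReal.ofReal (W x) * ‖Ψ x‖ₑ ^ 2 := by
        rw [← lintegral_const_mul' _ _ ENNReal.ofNat_ne_top]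
        refine setLIntegral_mono' S.measurableSet_halfOpen fun x hx => ?_
        rw [← mul_assoc, ← ENNReal.ofReal_ofNat 8, ← ENNReal.ofReal_mul (by norm_num)]
        gcongr
        exact le_locPotential hp hε hB hφ hS hx
      -- Again $7\varepsilon\le\frac12$ because $L\ge1$, and $\frac12\cdot8=4$.
      calc _ ≤ ENNReal.ofReal (1 / 2) *
            (8 * ∫⁻ x in S.halfOpen, ENNReal.ofReal (W x) * ‖Ψ x‖ₑ ^ 2) := by
            gcongr
            nlinarith
        _ = _ := by
            rw [← mul_assoc, ← ENNReal.ofReal_ofNat 8, ← ENNReal.ofReal_mul (by norm_num)]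
            norm_num
  rw [schrodingerForm, potentialForm, lintegral_eq_tsum_maximal hp hε hB hL,
    lintegral_eq_tsum_maximal hp hε hB hL fun x => ∑ i : Fin 2, ‖magMomentum A i Ψ x‖ₑ ^ 2,
    lintegral_eq_tsum_maximal hp hε hB hL fun x => ENNReal.ofReal (W x) * ‖Ψ x‖ₑ ^ 2,
    ← ENNReal.tsum_mul_left, ← ENNReal.tsum_mul_left, ← ENNReal.tsum_add]
  exact ENNReal.tsum_le_tsum fun S => hloc S.1 S.2

end PauliDomination

end

open PauliDomination in
theorem mainTheorem4 (p : ℝ) (hp : 4 / 3 < p) :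
    ∃ C : ℝ, 0 < C ∧
      ∀ (e g Bext s : ℝ) (b : Plane → ℝ) (a : Plane → Plane),
        e ≠ 0 → 0 < Bext → (s = 1 ∨ s = -1) →
        (MemLp b (ENNReal.ofReal p) volume ∨
          (LocMemLp b (ENNReal.ofReal p) ∧ VanishesAtInfinity b)) →
        LocMemLp a 2 → IsDistribCurl a b →
        ∃ ε₀ : ℝ, 0 < ε₀ ∧ ∀ ε : ℝ, 0 < ε → ε < ε₀ →
          ∀ φ : maximalSquares (totalField e g Bext s b) p ε → Plane → ℝ,
            IsSquarePartition (maximalSquares (totalField e g Bext s b) p ε) φ →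
            FormLE (schrodingerForm (totalPotential e g Bext s a)) C
              (fun Ψ => pauliForm (totalPotential e g Bext s a) Ψ +
                potentialForm
                  (locPotential (maximalSquares (totalField e g Bext s b) p ε) φ) Ψ) := by
  -- From $q\le P+\frac12q+4V$ one gets $q\le2P+8V\le8(P+V)$.
  refine ⟨8, by norm_num, fun e g Bext s b a he hBext _ hb ha hcurl => ?_⟩
  have hp1 : 1 ≤ ENNReal.ofReal p := by
    rw [← ENNReal.ofReal_one]; exact ENNReal.ofReal_le_ofReal (by linarith)
  have hloc : LocMemLp b (ENNReal.ofReal p) := hb.elim (fun h K _ => h.restrict K) And.left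
  have hbi := hloc.locallyIntegrable hp1
  obtain ⟨L, hL1, hL⟩ := exists_side_bound_totalField (g := g) (s := s) hp he hBext hloc
    hbi.aestronglyMeasurable (hb.imp_right And.right)
  -- This is $14\varepsilon L<1$; since $L\ge1$ it also yields $\varepsilon\le1$, as the side bound
  -- requires.
  refine ⟨1 / (14 * L), by positivity, fun ε hε hεL φ hφ => FormLE.of_test (by norm_num) fun Ψ hΨ => ?_⟩
  rw [lt_div_iff₀ (by positivity)] at hεL
  have hA := ha.totalPotential e g Bext s
  have hB := hloc.totalField e g Bext s
  have hBi := hB.locallyIntegrable hp1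
  have h1 := schrodingerForm_le hA hBi (hcurl.total ha hbi e g Bext s) hΨ
  have h2 := lintegral_field_mul_le hp hε hA hB hBi.aestronglyMeasurable hL1
    (hL ε (by nlinarith)) (by linarith) hφ hΨ
  have hfin := schrodingerForm_ne_top hA hΨ
  set q := schrodingerForm (totalPotential e g Bext s a) Ψ
  set P := pauliForm (totalPotential e g Bext s a) Ψ
  set V := potentialForm (locPotential (maximalSquares (totalField e g Bext s b) p ε) φ) Ψ
  have h3 : q ≤ P + (ENNReal.ofReal (1 / 2) * q + 4 * V) := h1.trans (by gcongr)
  clear_value q P V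
  clear h1 h2
  -- If `P` or `V` is infinite there is nothing to prove; otherwise all three quantities are finite
  -- and $\frac12q$ can be subtracted.
  by_cases hV : V = ⊤
  · simp [hV]
  by_cases hP : P = ⊤
  · simp [hP]
  lift q to NNReal using hfin
  lift P to NNReal using hP
  lift V to NNReal using hV
  have h4 : ENNReal.ofReal (1 / 2) = ((1 / 2 : NNReal) : ℝ≥0∞) := by
    rw [ENNReal.ofReal, ENNReal.coe_inj, Real.toNNReal_div (by norm_num)]; simp
  rw [h4] at h3
  rw [ENNReal.ofReal_ofNat, show (8 : ℝ≥0∞) = ((8 : NNReal) : ℝ≥0∞) from rfl]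
  norm_cast at h3 ⊢
  rw [← NNReal.coe_le_coe] at h3 ⊢
  push_cast at h3 ⊢
  linarith [P.coe_nonneg, V.coe_nonneg]
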